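/- Let $Q(Y,X)\in\mathbb{Q}[Y,X]$ be square-free, of degree $d$ in $X$. For all sufficiently small real $y>0$ let $\rho_1(y)>\rho_2(y)>\dots>\rho_\ell(y)$ be the distinct moduli of the complex roots of $Q(y,X)$, and let $q_i(y)$ be the number of roots of modulus $\rho_i(y)$. Then the list $(q_1(y),\dots,q_\ell(y))$ does not depend on $y$ for $y>0$ small enough, and the following algorithm terminates and returns this constant list $(q_1,\dots,q_\ell)$. For a polynomial $R\in\mathbb{Q}(Y)[X]$ with roots $Z_1,\dots,Z_r$ (with multiplicity, in an algebraic closure of $\mathbb{Q}(Y)$), the procedure $\mathrm{Dom}(R)$ is: 1. Compute $T=R\otimes R=\prod_{1\le i,j\le r}(X-Z_iZ_j)\in\mathbb{Q}(Y)[X]$. 2. Compute the square-free decomposition $T=P_0P_1P_2^2\cdots P_k^k$ with respect to $X$, where $P_0\in\mathbb{Q}(Y)$ is nonzero and $P_1,\dots,P_k\in\mathbb{Q}(Y)[X]$ are square-free and pairwise coprime. 3. For $N=0,1,2,\dots$ compute, for all $i$, the Puiseux expansions at $Y=0$ (series in rational powers of $Y$ with complex coefficients) of the roots $\beta_{i,j}$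 of $P_i$, truncated to the finitely many terms of exponent less than $N$. Stop at the first $N$ for which the truncations identify a nonnegative real root of greatest modulus as $Y$ decreases to $0$, that is, for which there is $(i_0,j_0)$ such that the truncation of $\beta_{i_0,j_0}$ has real coefficients, is nonnegative as $Y\to0^+$, differs from the truncations of all the other $\beta_{i,j}$, and is larger as $Y\to0^+$ than every other truncation that has real coefficients and is nonnegative as $Y\to0^+$. 4. Return $i_0$. The algorithm itself starts with the empty list. As long as the numbers $q_1,\dots,q_j$ found so far satisfy $q_1+\dots+q_j<d$, it puts $m=q_1+\dots+q_j+1$ and $q_{j+1}=\mathrm{Dom}(\mathcal{P}_m)$, where $$\mathcal{P}_m=\prod_{1\le i_1<\dots<i_m\le d}\bigl(X-X_{i_1}X_{i_2}\cdots X_{i_m}\bigr)\in\mathbb{Q}(Y)[X]$$ and $X_1,\dots,X_d$ are the roots of $Q$ in an algebraic closure of $\mathbb{Q}(Y)$ (so $\mathcal{P}_1$ is $Q$ divided by its leading coefficient in $X$). It returns $(q_1,\dots,q_j)$ as soon as $q_1+\dots+q_j=d$. -/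

import Mathlib

open Filter Topology

noncomputable section

namespace RootModuli

/-! ### Polynomials over `ℚ(Y)` and their roots

A bivariate polynomial `Q(Y,X) ∈ ℚ[Y,X]` is an element of `ℚ[Y][X]`, i.e. of
`Polynomial (Polynomial ℚ)`; the inner variable is the parameter `Y`. -/

/-- The field `ℚ(Y)`. -/
abbrev K : Type := RatFunc ℚ

/-- An algebraic closure of `ℚ(Y)`, in which the roots `X_1, …, X_d` of `Q_Y` live. -/
abbrev L : Type := AlgebraicClosure K

/-- `Q(Y,X)` regarded as a polynomial in `X` over `ℚ(Y)`. -/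
def overField (Q : Polynomial (Polynomial ℚ)) : Polynomial K :=
  Q.map (algebraMap (Polynomial ℚ) K)

/-- For a multiset `s` of algebraic functions that is stable under conjugation over `ℚ(Y)`,
the unique polynomial over `ℚ(Y)` that equals `∏_{a ∈ s} (X - a)`. See `polyOfRoots_map`. -/
def polyOfRoots (s : Multiset L) : Polynomial K :=
  Function.invFun (Polynomial.map (algebraMap K L))
    (s.map fun a => Polynomial.X - Polynomial.C a).prod

theorem polyOfRoots_map (s : Multiset L) (hs : ∀ σ : L ≃ₐ[K] L, s.map σ = s) :
    (polyOfRoots s).map (algebraMap K L)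
      = (s.map fun a => Polynomial.X - Polynomial.C a).prod := by
  apply Function.invFun_eq (f := Polynomial.map (algebraMap K L))
  have hlift : (s.map fun a => Polynomial.X - Polynomial.C a).prod
      ∈ Polynomial.lifts (algebraMap K L) := by
    rw [Polynomial.lifts_iff_coeff_lifts]
    intro n
    have := (InfiniteGalois.mem_range_algebraMap_iff_fixed (k := K) (K := L)
      ((s.map fun a => Polynomial.X - Polynomial.C a).prod.coeff n)).2 ?_
    · exact this
    · intro σ
      have h1 : ((s.map fun a => Polynomial.X - Polynomial.C a).prod).map (σ : L →+* L)
          = (s.map fun a => Polynomial.X - Polynomial.C a).prod := by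
        rw [Polynomial.map_multiset_prod, Multiset.map_map]
        conv_rhs => rw [← hs σ, Multiset.map_map]
        congr 1
        apply Multiset.map_congr rfl
        intro a _
        simp
      have h2 := congrArg (fun p => p.coeff n) h1
      simpa [Polynomial.coeff_map] using h2
  obtain ⟨p, hp⟩ := (Polynomial.mem_lifts _).1 hlift
  exact ⟨p, hp⟩

theorem aroots_map_equiv (f : Polynomial K) (σ : L ≃ₐ[K] L) :
    (f.aroots L).map σ = f.aroots L := by
  have h := Polynomial.roots_map_of_injective_of_card_eq_natDegree
    (p := f.map (algebraMap K L)) (f := (σ : L →+* L)) σ.injective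
    (IsAlgClosed.card_roots_eq_natDegree)
  rw [Polynomial.map_map] at h
  have h3 : (σ : L →+* L).comp (algebraMap K L) = algebraMap K L := by
    ext x; simp
  rw [h3] at h
  exact h

/-- The tensor product `f ⊗ f = ∏_{i,j} (X - X_i X_j)`, where `X_1, …, X_d` are the roots of `f`
and `(i,j)` runs over all ordered pairs. -/
def tensorSquare (f : Polynomial K) : Polynomial K :=
  polyOfRoots ((f.aroots L ×ˢ f.aroots L).map fun p => p.1 * p.2)

theorem tensorSquare_map (f : Polynomial K) :
    (tensorSquare f).map (algebraMap K L)
      = (((f.aroots L ×ˢ f.aroots L).map fun p => p.1 * p.2).map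
          fun a => Polynomial.X - Polynomial.C a).prod := by
  apply polyOfRoots_map
  intro σ
  conv_rhs => rw [← aroots_map_equiv f σ]
  simp only [SProd.sprod, Multiset.product, Multiset.map_bind, Multiset.bind_map, Multiset.map_map]
  congr 1
  funext x
  apply Multiset.map_congr rfl
  intro y _
  simp

/-- `𝒫_m = ∏_{i_1 < ⋯ < i_m} (X - X_{i_1} ⋯ X_{i_m})`, where `X_1, …, X_d` are the roots of `f`. -/
def subsetProducts (f : Polynomial K) (m : ℕ) : Polynomial K :=
  polyOfRoots ((Multiset.powersetCard m (f.aroots L)).map Multiset.prod)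

theorem subsetProducts_map (f : Polynomial K) (m : ℕ) :
    (subsetProducts f m).map (algebraMap K L)
      = (((Multiset.powersetCard m (f.aroots L)).map Multiset.prod).map
          fun a => Polynomial.X - Polynomial.C a).prod := by
  apply polyOfRoots_map
  intro σ
  conv_rhs => rw [← aroots_map_equiv f σ, Multiset.powersetCard_map]
  rw [Multiset.map_map, Multiset.map_map]
  apply Multiset.map_congr rfl
  intro s _
  simpa using map_multiset_prod σ s

/-! ### Square-free decomposition -/

open Classical in
/-- The factor `P_i` of the square-free decomposition `T = P_0 P_1 P_2² ⋯ P_k^k` with respect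
to `X`: the product of the monic irreducible factors of `T` in `ℚ(Y)[X]` of multiplicity exactly
`i`. (Here `P_0 ∈ ℚ(Y)` is the leading coefficient, and `P_i = 1` for `i > deg T`.) -/
def squarefreeFactor (T : Polynomial K) (i : ℕ) : Polynomial K :=
  ∏ p ∈ (UniqueFactorizationMonoid.normalizedFactors T).toFinset.filter
    (fun p => (UniqueFactorizationMonoid.normalizedFactors T).count p = i), p

theorem squarefreeFactor_spec (T : Polynomial K) (hT : T ≠ 0) :
    T = Polynomial.C T.leadingCoeff * ∏ i ∈ Finset.Icc 1 T.natDegree, squarefreeFactor T i ^ i ∧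
    (∀ i, Squarefree (squarefreeFactor T i)) ∧
    (∀ i j, i ≠ j → IsCoprime (squarefreeFactor T i) (squarefreeFactor T j)) := by
  classical
  set F := UniqueFactorizationMonoid.normalizedFactors T with hF
  have hirr : ∀ p ∈ F, Irreducible p := fun p hp =>
    UniqueFactorizationMonoid.irreducible_of_normalized_factor p hp
  have hmon : ∀ p ∈ F, normalize p = p := fun p hp =>
    UniqueFactorizationMonoid.normalize_normalized_factor p hp
  have hcop : ∀ p ∈ F, ∀ q ∈ F, p ≠ q → IsCoprime p q := by
    intro p hp q hq hpq
    refine ((hirr p hp).coprime_iff_not_dvd).2 fun hd => hpq ?_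
    have := (hirr p hp).associated_of_dvd (hirr q hq) hd
    rw [← hmon p hp, ← hmon q hq]
    exact normalize_eq_normalize_iff_associated.2 this
  refine ⟨?_, ?_, ?_⟩
  · have hprod : F.prod = ∏ i ∈ Finset.Icc 1 T.natDegree, squarefreeFactor T i ^ i := by
      have hmaps : ∀ p ∈ F.toFinset, F.count p ∈ Finset.Icc 1 T.natDegree := by
        intro p hp
        have hpF := Multiset.mem_toFinset.1 hp
        rw [Finset.mem_Icc]
        refine ⟨Multiset.one_le_count_iff_mem.2 hpF, ?_⟩
        have h1 : p ^ F.count p ∣ T := by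
          refine dvd_trans ?_
            (UniqueFactorizationMonoid.prod_normalizedFactors hT).dvd
          rw [← Multiset.prod_replicate]
          exact Multiset.prod_dvd_prod_of_le (Multiset.le_count_iff_replicate_le.1 le_rfl)
        have h2 := Polynomial.natDegree_le_of_dvd h1 hT
        rw [Polynomial.natDegree_pow] at h2
        have h3 := (hirr p hpF).natDegree_pos
        nlinarith
      rw [Finset.prod_multiset_count, ← Finset.prod_fiberwise_of_maps_to hmaps]
      apply Finset.prod_congr rfl
      intro i _
      rw [squarefreeFactor, ← Finset.prod_pow]
      apply Finset.prod_congr rfl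
      intro p hp
      rw [(Finset.mem_filter.1 hp).2]
    rw [← hprod, hF, Polynomial.leadingCoeff_mul_prod_normalizedFactors]
  · intro i
    apply Finset.squarefree_prod_of_pairwise_isCoprime
    · intro p hp q hq hpq
      rw [Finset.mem_coe, Finset.mem_filter, Multiset.mem_toFinset] at hp hq
      exact (hcop p hp.1 q hq.1 hpq).isRelPrime
    · intro p hp
      rw [Finset.mem_filter, Multiset.mem_toFinset] at hp
      exact (hirr p hp.1).squarefree
  · intro i j hij
    apply IsCoprime.prod_left
    intro p hp
    apply IsCoprime.prod_right
    intro q hq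
    rw [Finset.mem_filter, Multiset.mem_toFinset] at hp hq
    exact hcop p hp.1 q hq.1 fun h => hij (by rw [← hp.2, ← hq.2, h])

/-! ### Puiseux expansions at `Y = 0` -/

/-- Generalized power series `∑ c_e Y^e` with `c_e ∈ ℂ` and exponents `e ∈ ℚ`. -/
abbrev Series : Type := HahnSeries ℚ ℂ

/-- `s` is a Puiseux series: its exponents have a common denominator. (They are bounded below
because the support of `s` is well-ordered.) -/
def IsPuiseux (s : Series) : Prop :=
  ∃ m : ℕ, 0 < m ∧ ∀ e ∈ s.support, ∃ k : ℤ, e = (k : ℚ) / (m : ℚ)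

/-- A polynomial in `Y` as a Puiseux series. -/
def polyToSeries : Polynomial ℚ →+* Series :=
  (HahnSeries.ofPowerSeries ℚ ℂ).comp
    (Polynomial.coeToPowerSeries.ringHom.comp (Polynomial.mapRingHom (algebraMap ℚ ℂ)))

theorem polyToSeries_injective : Function.Injective polyToSeries := by
  intro p q h
  have h1 := HahnSeries.ofPowerSeries_injective h
  have h2 := Polynomial.coe_injective ℂ h1
  exact Polynomial.map_injective _ (algebraMap ℚ ℂ).injective h2

/-- A rational function in `Y` as a Puiseux series: its expansion at `Y = 0`. -/
def toSeries : K →+* Series :=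
  RatFunc.liftRingHom polyToSeries
    (nonZeroDivisors_le_comap_nonZeroDivisors_of_injective _ polyToSeries_injective)

open Classical in
/-- The Puiseux expansions at `Y = 0` of the roots of `g ∈ ℚ(Y)[X]`, with multiplicity. -/
def puiseuxRoots (g : Polynomial K) : Multiset Series :=
  (g.map toSeries).roots.filter IsPuiseux

/-- The expansions up to order `N` of all roots `β_{i,j}` of the factors `P_i` of the square-free
decomposition of `T`: the list of all pairs `(i, β_{i,j} mod Y^N)`. Each truncated expansion is a
finite sum `∑_{e < N} c_e Y^e`. -/
def truncatedRoots (T : Polynomial K) (N : ℕ) : Multiset (ℕ × Series) :=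
  (Finset.Icc 1 T.natDegree).val.bind fun i =>
    (puiseuxRoots (squarefreeFactor T i)).map fun β => (i, HahnSeries.truncLT (N : ℚ) β)

/-- `t(Y)` has real coefficients. -/
def IsRealSeries (t : Series) : Prop := ∀ e : ℚ, (t.coeff e).im = 0

/-- `t(Y)` is real and `t(Y) ≥ 0` as `Y` decreases to `0`: the lowest coefficient decides. -/
def IsNonnegSeries (t : Series) : Prop := IsRealSeries t ∧ 0 ≤ t.leadingCoeff.re

/-- For real `s`, `t`: `s(Y) < t(Y)` as `Y` decreases to `0`. -/
def SeriesLT (s t : Series) : Prop := 0 < (t - s).leadingCoeff.re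

open Classical in
/-- The test made on a list of truncated expansions: the entry `e = (i_0, t_0)` is recognized as
coming from the nonnegative real root of greatest modulus.

* The truncation `t_0` is real and nonnegative.
* No other entry has the same truncation. Since the roots of each `P_i` are stable under complex
  conjugation, the root with truncation `t_0` is then itself real.
* Every other entry whose truncation is real and nonnegative (so that it might come from a
  nonnegative real root) has a smaller truncation. -/
def IsDominantEntry (E : Multiset (ℕ × Series)) (e : ℕ × Series) : Prop :=
  e ∈ E ∧ IsNonnegSeries e.2 ∧ (E.map Prod.snd).count e.2 = 1 ∧
    ∀ e' ∈ E, e' ≠ e → IsNonnegSeries e'.2 → SeriesLT e'.2 e.2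

/-! ### The algorithm -/

open Classical in
/-- Steps 1 to 5, applied to `R`: form `R ⊗ R` and its square-free decomposition, expand the roots
`β_{i,j}` of the factors `P_i` to order `N = 0, 1, 2, …` until some `(i_0, j_0)` is recognized as
the index of the nonnegative real root of greatest modulus, and return `i_0`. The value is
undefined if the search over `N` does not stop. -/
def dominantIndex (R : Polynomial K) : Part ℕ :=
  (Nat.rfind fun N => Part.some (decide
    (∃ e, IsDominantEntry (truncatedRoots (tensorSquare R) N) e))).bind fun N =>
      Part.assert (∃ e, IsDominantEntry (truncatedRoots (tensorSquare R) N) e) fun h =>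
        Part.some h.choose.1

/-- One round of the main loop. The state is the list `[q_1, …, q_j]` found so far. If these
numbers exhaust the degree `d`, the list is returned. Otherwise steps 1 to 5 are applied to `𝒫_m`
with `m = q_1 + ⋯ + q_j + 1`, which gives `q_{j+1}`. At the start `m = 1`, and `𝒫_1` is `f` itself,
made monic. -/
def round (f : Polynomial K) (qs : List ℕ) : Part (List ℕ ⊕ List ℕ) :=
  if qs.sum < f.natDegree then
    (dominantIndex (subsetProducts f (qs.sum + 1))).map fun q => Sum.inr (qs ++ [q])
  else Part.some (Sum.inl qs)

/-- The algorithm, on input `Q(Y,X)`: iterate `round` from the empty list until it returns. The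
value is undefined if one of the loops does not terminate. -/
def algorithm (Q : Polynomial (Polynomial ℚ)) : Part (List ℕ) :=
  PFun.fix (round (overField Q)) []

/-! ### The quantities to be computed -/

/-- `Q(y, X) ∈ ℂ[X]` for a real number `y`. -/
def specialize (Q : Polynomial (Polynomial ℚ)) (y : ℝ) : Polynomial ℂ :=
  Q.map (Polynomial.eval₂RingHom (algebraMap ℚ ℂ) (y : ℂ))

open Classical in
/-- The list of the distinct moduli `ρ_1 > ρ_2 > ⋯ > ρ_ℓ` of the complex roots of `p`. -/
def moduli (p : Polynomial ℂ) : List ℝ :=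
  (p.roots.toFinset.image fun z => ‖z‖).sort (fun a b => a ≥ b)

open Classical in
/-- The list `[q_1, …, q_ℓ]`, where `q_i` is the number of roots of `p` of modulus `ρ_i`. -/
def moduliCounts (p : Polynomial ℂ) : List ℕ :=
  (moduli p).map fun r => p.roots.countP fun z => ‖z‖ = r

end RootModuli

end

/-!
The list of root counts is constant near `0` because the algorithm, which knows nothing of `y`,
returns it for every small `y > 0` (`eventually_algorithm_eq`). To see this, the roots of `Q` are
realized as functions of `y`.

**Convergent Puiseux series.** A series with exponents in `(1/m)ℤ` that converges absolutely for
small `y > 0` has a value there. Values are additive and multiplicative, commute with complex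
conjugation, and are asymptotic to the leading term; hence equality, reality and sign of series can
be read off from their values at small `y`. These series form an algebraically closed field
`ConvPuiseux`. The proof is that of Newton and Puiseux: after a translation and a substitution
`X ↦ Y^r X` the constant terms of the coefficients form a polynomial over `ℂ` with two coprime
factors of smaller degree, and Hensel's lemma lifts the factorization. A series with nonnegative
exponents is an analytic function of `t = y^(1/m)`, so Hensel's lemma is needed for analytic
coefficients only, where it is the inverse function theorem for the multiplication of monic
polynomials (`exists_analytic_factorization`). The algebraic closure of `ℚ(Y)` therefore embeds into
`ConvPuiseux` (`embed`), every root of every polynomial over `ℚ(Y)` has a Puiseux expansion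
(`puiseuxRoots_eq`), and for small `y > 0` the values of the expansions of the roots of `Q` are the
roots of `Q(y, X)` (`eventually_roots_specialize`).

**The procedure `Dom`.** Let `z₀` be the greatest root of `T = R ⊗ R` that is real and nonnegative.
If the truncations are long enough, the truncation of `z₀` passes the test. Conversely, a root whose
truncation passes is real, since its conjugate has the same truncation, and it cannot differ from
`z₀`, since then its truncation, and hence it, would be greater than `z₀`. The procedure thus
terminates and returns the multiplicity of `z₀` in `T` (`dominantIndex_eq`).

**The rounds.** Let `m - 1` be the number of roots of modulus greater than `ρ`, where `ρ` is the
modulus of some root. The `m`-fold products of greatest modulus are the products `P c`, where `P` is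
the product of all roots of modulus `> ρ` and `c` is a root of modulus `ρ`. All products of two
`m`-fold products have modulus at most `M = (|P| ρ)²`, and since `P` is real, `P c · P c' = M` holds
exactly for `c' = conj c`. So the greatest nonnegative root of `𝒫_m ⊗ 𝒫_m` is `M`, and its
multiplicity is the number of roots of modulus `ρ`, because the roots of `Q` are distinct
(`count_productPairs`).
-/

noncomputable section

namespace RootModuli

/-! ### Values of generalized power series at positive real numbers -/

/-- The series `s` converges absolutely at the real number `y`, with sum `z`. -/
def HasValue (s : Series) (y : ℝ) (z : ℂ) : Prop :=
  HasSum (fun e : ℚ => s.coeff e * ((y ^ (e : ℝ) : ℝ) : ℂ)) z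

/-- The sum of the series `s` at the real number `y` (zero if it does not converge). -/
def value (s : Series) (y : ℝ) : ℂ := ∑' e : ℚ, s.coeff e * ((y ^ (e : ℝ) : ℝ) : ℂ)

/-- The series `s` converges absolutely at the real number `y`. -/
def ConvAt (s : Series) (y : ℝ) : Prop :=
  Summable fun e : ℚ => s.coeff e * ((y ^ (e : ℝ) : ℝ) : ℂ)

theorem ConvAt.hasValue {s : Series} {y : ℝ} (h : ConvAt s y) : HasValue s y (value s y) :=
  Summable.hasSum h

theorem HasValue.convAt {s : Series} {y : ℝ} {z : ℂ} (h : HasValue s y z) : ConvAt s y :=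
  HasSum.summable h

theorem HasValue.value_eq {s : Series} {y : ℝ} {z : ℂ} (h : HasValue s y z) : value s y = z :=
  HasSum.tsum_eq h

theorem HasValue.add {s t : Series} {y : ℝ} {a b : ℂ} (hs : HasValue s y a)
    (ht : HasValue t y b) : HasValue (s + t) y (a + b) := by
  have := HasSum.add hs ht
  unfold HasValue
  convert this using 2 with e
  rw [HahnSeries.coeff_add]; ring

theorem HasValue.neg {s : Series} {y : ℝ} {a : ℂ} (hs : HasValue s y a) :
    HasValue (-s) y (-a) := by
  have := HasSum.neg hs
  unfold HasValue
  have h : (fun e : ℚ => (-s).coeff e * ((y ^ (e : ℝ) : ℝ) : ℂ)) =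
      fun e : ℚ => -(s.coeff e * ((y ^ (e : ℝ) : ℝ) : ℂ)) := by
    funext e
    rw [HahnSeries.coeff_neg, neg_mul]
  rw [h]
  exact this

theorem HasValue.sub {s t : Series} {y : ℝ} {a b : ℂ} (hs : HasValue s y a)
    (ht : HasValue t y b) : HasValue (s - t) y (a - b) := by
  simpa [sub_eq_add_neg] using hs.add ht.neg

theorem hasValue_single (e : ℚ) (c : ℂ) (y : ℝ) :
    HasValue (HahnSeries.single e c) y (c * ((y ^ (e : ℝ) : ℝ) : ℂ)) := by
  unfold HasValue
  convert hasSum_single e ?_ using 1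
  · rw [HahnSeries.coeff_single_same]
  · intro e' he
    rw [HahnSeries.coeff_single_of_ne he, zero_mul]

theorem hasValue_zero (y : ℝ) : HasValue 0 y 0 := by
  simpa using hasValue_single 0 0 y

theorem hasValue_one (y : ℝ) : HasValue 1 y 1 := by
  simpa using hasValue_single 0 1 y

/-- Values multiply: absolutely convergent double series may be summed along the diagonals
`e₁ + e₂ = e`, which are finite on the support of the product. -/
theorem HasValue.mul {s t : Series} {y : ℝ} (hy : 0 < y) {a b : ℂ} (hs : HasValue s y a)
    (ht : HasValue t y b) : HasValue (s * t) y (a * b) := by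
  have hs' : Summable fun e : ℚ => ‖s.coeff e * ((y ^ (e : ℝ) : ℝ) : ℂ)‖ := hs.summable.norm
  have ht' : Summable fun e : ℚ => ‖t.coeff e * ((y ^ (e : ℝ) : ℝ) : ℂ)‖ := ht.summable.norm
  have h1 : HasSum (fun p : ℚ × ℚ => (s.coeff p.1 * ((y ^ (p.1 : ℝ) : ℝ) : ℂ)) *
      (t.coeff p.2 * ((y ^ (p.2 : ℝ) : ℝ) : ℂ))) (a * b) := by
    have := (summable_mul_of_summable_norm hs' ht').hasSum
    rwa [← tsum_mul_tsum_of_summable_norm hs' ht', HasSum.tsum_eq hs, HasSum.tsum_eq ht] at this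
  -- the shear `(e, e₁) ↦ (e₁, e - e₁)` turns diagonals into fibres
  let φ : ℚ × ℚ ≃ ℚ × ℚ :=
    { toFun := fun p => (p.2, p.1 - p.2)
      invFun := fun p => (p.1 + p.2, p.1)
      left_inv := fun p => by ext <;> simp
      right_inv := fun p => by ext <;> simp }
  have h2 := (φ.hasSum_iff).2 h1
  refine HasSum.prod_fiberwise h2 fun e => ?_
  have hfun : (fun e₁ : ℚ => ((fun p : ℚ × ℚ => (s.coeff p.1 * ((y ^ (p.1 : ℝ) : ℝ) : ℂ)) *
      (t.coeff p.2 * ((y ^ (p.2 : ℝ) : ℝ) : ℂ))) ∘ φ) (e, e₁)) =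
      fun e₁ : ℚ => (s.coeff e₁ * t.coeff (e - e₁)) * ((y ^ (e : ℝ) : ℝ) : ℂ) := by
    funext e₁
    have : y ^ (e : ℝ) = y ^ (e₁ : ℝ) * y ^ ((e - e₁ : ℚ) : ℝ) := by
      rw [← Real.rpow_add hy]; push_cast; congr 1; ring
    simp only [Function.comp, φ, Equiv.coe_fn_mk, this]
    push_cast
    ring
  rw [hfun]
  apply HasSum.mul_right
  rw [HahnSeries.coeff_mul]
  set A := Finset.antidiagonal s.isPWO_support t.isPWO_support e with hA
  have hinj : ∀ p ∈ A, p = (p.1, e - p.1) := by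
    intro p hp
    have := (Finset.mem_antidiagonal.1 hp).2.2
    ext <;> simp [← this]
  have hsum : ∑ p ∈ A, s.coeff p.1 * t.coeff p.2 =
      ∑ e₁ ∈ A.image Prod.fst, s.coeff e₁ * t.coeff (e - e₁) := by
    rw [Finset.sum_image]
    · refine Finset.sum_congr rfl fun p hp => ?_
      conv_lhs => rw [hinj p hp]
    · intro p hp q hq hpq
      rw [hinj p hp, hinj q hq, hpq]
  rw [hsum]
  refine hasSum_sum_of_ne_finset_zero fun e₁ he₁ => ?_
  by_contra hne
  refine he₁ (Finset.mem_image.2 ⟨(e₁, e - e₁), Finset.mem_antidiagonal.2 ⟨?_, ?_, ?_⟩, rfl⟩)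
  · exact left_ne_zero_of_mul hne
  · exact right_ne_zero_of_mul hne
  · simp

/-- Complex conjugation of the coefficients of a series. -/
def conjSeries : Series →+* Series where
  toFun s := s.map (starRingEnd ℂ)
  map_zero' := by ext; simp
  map_one' := by
    ext e
    simp only [HahnSeries.map_coeff, HahnSeries.coeff_one]
    split_ifs <;> simp
  map_add' s t := by ext; simp
  map_mul' s t := HahnSeries.map_mul (starRingEnd ℂ : ℂ →ₙ+* ℂ)

@[simp] theorem conjSeries_coeff (s : Series) (e : ℚ) :
    (conjSeries s).coeff e = starRingEnd ℂ (s.coeff e) := rfl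

theorem HasValue.conj {s : Series} {y : ℝ} {a : ℂ} (hs : HasValue s y a) :
    HasValue (conjSeries s) y (starRingEnd ℂ a) := by
  have := HasSum.map hs (starRingEnd ℂ) Complex.continuous_conj
  unfold HasValue
  convert this using 2 with e
  simp

theorem isRealSeries_iff {s : Series} : IsRealSeries s ↔ conjSeries s = s := by
  constructor
  · intro h; ext e; simp [Complex.conj_eq_iff_im.2 (h e)]
  · intro h e
    rw [← Complex.conj_eq_iff_im, ← conjSeries_coeff, h]

theorem ConvAt.mono {s : Series} {y₀ y : ℝ} (h : ConvAt s y₀) (hy : 0 < y) (hle : y ≤ y₀) :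
    ConvAt s y := by
  have hy₀ : 0 < y₀ := hy.trans_le hle
  refine Summable.of_norm_bounded (g := fun e : ℚ => (y / y₀) ^ (s.order : ℝ) *
    ‖s.coeff e * ((y₀ ^ (e : ℝ) : ℝ) : ℂ)‖) (h.norm.mul_left _) fun e => ?_
  by_cases he : s.coeff e = 0
  · simp [he]
  have hoe := HahnSeries.order_le_of_coeff_ne_zero he
  rw [norm_mul, norm_mul, Complex.norm_real, Complex.norm_real,
    Real.norm_of_nonneg (Real.rpow_nonneg hy.le _), Real.norm_of_nonneg (Real.rpow_nonneg hy₀.le _)]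
  have h1 : y ^ (e : ℝ) = (y / y₀) ^ (e : ℝ) * y₀ ^ (e : ℝ) := by
    rw [← Real.mul_rpow (by positivity) hy₀.le, div_mul_cancel₀ _ hy₀.ne']
  rw [h1]
  have h2 : (y / y₀) ^ (e : ℝ) ≤ (y / y₀) ^ (s.order : ℝ) :=
    Real.rpow_le_rpow_of_exponent_ge (by positivity) ((div_le_one hy₀).2 hle)
      (by exact_mod_cast hoe)
  have h3 : 0 ≤ ‖s.coeff e‖ * y₀ ^ (e : ℝ) := by positivity
  calc _ = (y / y₀) ^ (e : ℝ) * (‖s.coeff e‖ * y₀ ^ (e : ℝ)) := by ring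
    _ ≤ _ := mul_le_mul_of_nonneg_right h2 h3

theorem leadingCoeff_eq_coeff_order (s : Series) : s.leadingCoeff = s.coeff s.order := by
  by_cases h : s = 0
  · simp [h]
  · rw [HahnSeries.leadingCoeff, ← HahnSeries.order_eq_orderTop_of_ne_zero h]
    rfl

/-- A convergent series is asymptotic to its leading term as `y` decreases to `0`. -/
theorem ConvAt.tendsto_leadingCoeff {s : Series} {y₀ : ℝ} (hy₀ : 0 < y₀) (h : ConvAt s y₀) :
    Tendsto (fun y : ℝ => value s y * ((y ^ (-(s.order : ℝ)) : ℝ) : ℂ)) (𝓝[>] 0)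
      (𝓝 s.leadingCoeff) := by
  have key : Tendsto (fun y : ℝ => ∑' e : ℚ, s.coeff e * ((y ^ ((e : ℝ) - s.order) : ℝ) : ℂ))
      (𝓝[>] 0) (𝓝 (∑' e : ℚ, if e = s.order then s.leadingCoeff else 0)) := by
    refine tendsto_tsum_of_dominated_convergence
      (bound := fun e : ℚ => y₀ ^ (-(s.order : ℝ)) * ‖s.coeff e * ((y₀ ^ (e : ℝ) : ℝ) : ℂ)‖)
      (h.norm.mul_left _) (fun e => ?_) ?_
    · split_ifs with he
      · subst he
        simp [leadingCoeff_eq_coeff_order]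
      · by_cases hc : s.coeff e = 0
        · simp [hc]
        have hlt : s.order < e :=
          lt_of_le_of_ne (HahnSeries.order_le_of_coeff_ne_zero hc) (Ne.symm he)
        have hpos : (0 : ℝ) < (e : ℝ) - s.order := by
          rw [sub_pos]; exact_mod_cast hlt
        have h0 : Tendsto (fun y : ℝ => y ^ ((e : ℝ) - s.order)) (𝓝[>] 0) (𝓝 0) := by
          have := (Real.continuousAt_rpow_const 0 ((e : ℝ) - s.order) (Or.inr hpos.le)).tendsto
          rw [Real.zero_rpow hpos.ne'] at this
          exact this.mono_left nhdsWithin_le_nhds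
        have h1 := (Complex.continuous_ofReal.tendsto 0).comp h0
        simpa using h1.const_mul (s.coeff e)
    · have hev : ∀ᶠ y in 𝓝[>] (0 : ℝ), y ∈ Set.Ioc 0 y₀ := Ioc_mem_nhdsGT hy₀
      filter_upwards [hev] with y hy e
      by_cases hc : s.coeff e = 0
      · simp [hc]
      have hle : s.order ≤ e := HahnSeries.order_le_of_coeff_ne_zero hc
      have hpos : (0 : ℝ) ≤ (e : ℝ) - s.order := by
        rw [sub_nonneg]; exact_mod_cast hle
      rw [norm_mul, norm_mul, Complex.norm_real, Complex.norm_real,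
        Real.norm_of_nonneg (Real.rpow_nonneg hy.1.le _),
        Real.norm_of_nonneg (Real.rpow_nonneg hy₀.le _)]
      have : y ^ ((e : ℝ) - s.order) ≤ y₀ ^ (-(s.order : ℝ)) * y₀ ^ (e : ℝ) := by
        rw [← Real.rpow_add hy₀, neg_add_eq_sub]
        exact Real.rpow_le_rpow hy.1.le hy.2 hpos
      calc _ ≤ ‖s.coeff e‖ * (y₀ ^ (-(s.order : ℝ)) * y₀ ^ (e : ℝ)) := by gcongr
        _ = _ := by ring
  rw [tsum_ite_eq] at key
  refine key.congr' ?_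
  filter_upwards [self_mem_nhdsWithin] with y hy
  rw [value, ← tsum_mul_right]
  refine tsum_congr fun e => ?_
  rw [mul_assoc, ← Complex.ofReal_mul, ← Real.rpow_add hy, ← sub_eq_add_neg]

/-! ### The field of convergent Puiseux series -/

/-- The exponents of `s` lie in `(1/m)ℤ`. -/
def HasDenom (s : Series) (m : ℕ) : Prop := ∀ e ∈ s.support, ∃ k : ℤ, e = (k : ℚ) / (m : ℚ)

theorem HasDenom.of_dvd {s : Series} {m n : ℕ} (h : HasDenom s m) (hmn : m ∣ n) (hn : 0 < n) :
    HasDenom s n := by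
  intro e he
  obtain ⟨k, rfl⟩ := h e he
  obtain ⟨c, rfl⟩ := hmn
  have hm : (m : ℚ) ≠ 0 := by exact_mod_cast (Nat.pos_of_mul_pos_right hn).ne'
  have hc : (c : ℚ) ≠ 0 := by exact_mod_cast (Nat.pos_of_mul_pos_left hn).ne'
  refine ⟨k * c, ?_⟩
  push_cast
  field_simp

theorem HasDenom.add {s t : Series} {m : ℕ} (hs : HasDenom s m) (ht : HasDenom t m) :
    HasDenom (s + t) m := fun e he =>
  (HahnSeries.support_add_subset s t he).elim (hs e) (ht e)

theorem HasDenom.mul {s t : Series} {m : ℕ} (hs : HasDenom s m) (ht : HasDenom t m) :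
    HasDenom (s * t) m := by
  intro e he
  obtain ⟨a, ha, b, hb, rfl⟩ := Set.mem_add.1 (HahnSeries.support_mul_subset he)
  obtain ⟨k, rfl⟩ := hs a ha
  obtain ⟨l, rfl⟩ := ht b hb
  exact ⟨k + l, by push_cast; ring⟩

theorem hasDenom_single (e : ℚ) (c : ℂ) : HasDenom (HahnSeries.single e c) e.den := by
  intro e' he'
  rw [HahnSeries.eq_of_mem_support_single he']
  exact ⟨e.num, (Rat.num_div_den e).symm⟩

theorem isPuiseux_of_hasDenom {s : Series} {m : ℕ} (hm : 0 < m) (h : HasDenom s m) :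
    IsPuiseux s := ⟨m, hm, h⟩

theorem IsPuiseux.exists_common_denom {s t : Series} (hs : IsPuiseux s) (ht : IsPuiseux t) :
    ∃ m : ℕ, 0 < m ∧ HasDenom s m ∧ HasDenom t m := by
  obtain ⟨m, hm, hs⟩ := hs
  obtain ⟨n, hn, ht⟩ := ht
  have hmn : 0 < m * n := Nat.mul_pos hm hn
  exact ⟨m * n, hmn, HasDenom.of_dvd hs (dvd_mul_right _ _) hmn,
    HasDenom.of_dvd ht (dvd_mul_left _ _) hmn⟩

/-- A Puiseux series that converges at some, hence at every smaller, positive real number. -/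
def IsConvPuiseux (s : Series) : Prop := IsPuiseux s ∧ ∃ y : ℝ, 0 < y ∧ ConvAt s y

theorem IsConvPuiseux.eventually_convAt {s : Series} (hs : IsConvPuiseux s) :
    ∀ᶠ y : ℝ in 𝓝[>] 0, ConvAt s y := by
  obtain ⟨-, y₀, hy₀, h⟩ := hs
  filter_upwards [Ioc_mem_nhdsGT hy₀] with y hy using h.mono hy.1 hy.2

theorem IsConvPuiseux.of_eventually {s : Series} (hs : IsPuiseux s)
    (h : ∀ᶠ y : ℝ in 𝓝[>] 0, ConvAt s y) : IsConvPuiseux s := by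
  obtain ⟨y, hy, hy0⟩ := (h.and self_mem_nhdsWithin).exists
  exact ⟨hs, y, hy0, hy⟩

theorem IsConvPuiseux.eventually_hasValue {s : Series} (hs : IsConvPuiseux s) :
    ∀ᶠ y : ℝ in 𝓝[>] 0, HasValue s y (value s y) :=
  hs.eventually_convAt.mono fun _ h => h.hasValue

theorem isConvPuiseux_single (e : ℚ) (c : ℂ) : IsConvPuiseux (HahnSeries.single e c) :=
  ⟨isPuiseux_of_hasDenom e.den_pos (hasDenom_single e c), 1, one_pos,
    (hasValue_single e c 1).convAt⟩

theorem IsConvPuiseux.add {s t : Series} (hs : IsConvPuiseux s) (ht : IsConvPuiseux t) :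
    IsConvPuiseux (s + t) := by
  obtain ⟨m, hm, h1, h2⟩ := hs.1.exists_common_denom ht.1
  refine .of_eventually (isPuiseux_of_hasDenom hm (h1.add h2)) ?_
  filter_upwards [hs.eventually_hasValue, ht.eventually_hasValue] with y h1 h2
    using (h1.add h2).convAt

theorem IsConvPuiseux.mul {s t : Series} (hs : IsConvPuiseux s) (ht : IsConvPuiseux t) :
    IsConvPuiseux (s * t) := by
  obtain ⟨m, hm, h1, h2⟩ := hs.1.exists_common_denom ht.1
  refine .of_eventually (isPuiseux_of_hasDenom hm (h1.mul h2)) ?_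
  filter_upwards [hs.eventually_hasValue, ht.eventually_hasValue, self_mem_nhdsWithin]
    with y h1 h2 hy using (h1.mul hy h2).convAt

theorem IsConvPuiseux.neg {s : Series} (hs : IsConvPuiseux s) : IsConvPuiseux (-s) := by
  obtain ⟨⟨m, hm, h1⟩, y, hy, h2⟩ := hs
  exact ⟨⟨m, hm, fun e he => h1 e (by rwa [HahnSeries.support_neg] at he)⟩, y, hy,
    h2.hasValue.neg.convAt⟩

theorem IsConvPuiseux.conj {s : Series} (hs : IsConvPuiseux s) :
    IsConvPuiseux (conjSeries s) := by
  obtain ⟨⟨m, hm, h1⟩, y, hy, h2⟩ := hs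
  refine ⟨⟨m, hm, fun e he => h1 e ?_⟩, y, hy, h2.hasValue.conj.convAt⟩
  rw [HahnSeries.mem_support] at he ⊢
  intro h
  exact he (by rw [conjSeries_coeff, h, map_zero])

theorem IsConvPuiseux.tendsto_leadingCoeff {s : Series} (hs : IsConvPuiseux s) :
    Tendsto (fun y : ℝ => value s y * ((y ^ (-(s.order : ℝ)) : ℝ) : ℂ)) (𝓝[>] 0)
      (𝓝 s.leadingCoeff) := by
  obtain ⟨-, y₀, hy₀, h⟩ := hs
  exact h.tendsto_leadingCoeff hy₀

theorem IsConvPuiseux.eventually_value_ne_zero {s : Series} (hs : IsConvPuiseux s) (h : s ≠ 0) :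
    ∀ᶠ y : ℝ in 𝓝[>] 0, value s y ≠ 0 := by
  have := hs.tendsto_leadingCoeff.eventually_ne (HahnSeries.leadingCoeff_ne_zero.2 h)
  filter_upwards [this] with y hy h0
  exact hy (by rw [h0, zero_mul])

/-- The sign of the leading coefficient is the sign of the values near `0`. -/
theorem IsConvPuiseux.eventually_value_re_pos {s : Series} (hs : IsConvPuiseux s)
    (h : 0 < s.leadingCoeff.re) : ∀ᶠ y : ℝ in 𝓝[>] 0, 0 < (value s y).re := by
  have h1 := (Complex.continuous_re.tendsto _).comp hs.tendsto_leadingCoeff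
  filter_upwards [h1.eventually_const_lt h, self_mem_nhdsWithin] with y hy hy0
  simp only [Function.comp_apply, Complex.re_mul_ofReal] at hy
  exact pos_of_mul_pos_left hy (Real.rpow_nonneg (le_of_lt hy0) _)

theorem IsConvPuiseux.eq_of_eventually_value_eq {s t : Series} (hs : IsConvPuiseux s)
    (ht : IsConvPuiseux t) (h : ∃ᶠ y : ℝ in 𝓝[>] 0, value s y = value t y) : s = t := by
  by_contra hne
  have h1 := (hs.add ht.neg).eventually_value_ne_zero
    (by rwa [← sub_eq_add_neg, sub_ne_zero])
  obtain ⟨y, hy, hy1, hy2, hy3⟩ :=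
    (h.and_eventually (h1.and (hs.eventually_hasValue.and ht.eventually_hasValue))).exists
  exact hy1 (by rw [(hy2.add hy3.neg).value_eq, hy, add_neg_cancel])

/-! ### Convergent Puiseux series and analytic functions of `y ^ (1/m)` -/

theorem hasSum_pow_iff_hasValue {s : Series} {m : ℕ} (hm : 0 < m)
    (hs : ∀ e ∈ s.support, ∃ n : ℕ, e = (n : ℚ) / (m : ℚ)) {y : ℝ} (hy : 0 < y) (z : ℂ) :
    HasSum (fun n : ℕ => s.coeff ((n : ℚ) / m) * ((y ^ (1 / m : ℝ) : ℝ) : ℂ) ^ n) z ↔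
      HasValue s y z := by
  have hm' : (m : ℚ) ≠ 0 := by exact_mod_cast hm.ne'
  have hinj : Function.Injective fun n : ℕ => (n : ℚ) / (m : ℚ) := by
    intro a b h
    have h' := congrArg (· * (m : ℚ)) h
    simp only [div_mul_cancel₀ _ hm'] at h'
    exact_mod_cast h'
  unfold HasValue
  rw [← hinj.hasSum_iff]
  · refine iff_of_eq (congrArg (fun f => HasSum f z) ?_)
    funext n
    simp only [Function.comp]
    rw [← Complex.ofReal_pow, ← Real.rpow_natCast, ← Real.rpow_mul hy.le]
    congr 4
    push_cast
    ring
  · intro e he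
    have : s.coeff e = 0 := by
      by_contra hne
      obtain ⟨n, hn⟩ := hs e hne
      exact he ⟨n, hn.symm⟩
    rw [this, zero_mul]

theorem tendsto_rpow_one_div {m : ℕ} (hm : 0 < m) :
    Tendsto (fun y : ℝ => ((y ^ (1 / m : ℝ) : ℝ) : ℂ)) (𝓝[>] 0) (𝓝 0) := by
  have hpos : (0 : ℝ) < 1 / m := by positivity
  have := (Real.continuousAt_rpow_const 0 (1 / m : ℝ) (Or.inr hpos.le)).tendsto
  rw [Real.zero_rpow hpos.ne'] at this
  exact (Complex.continuous_ofReal.tendsto' 0 0 rfl).comp (this.mono_left nhdsWithin_le_nhds)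

theorem exists_series_of_analyticAt {m : ℕ} (hm : 0 < m) {F : ℂ → ℂ} (hF : AnalyticAt ℂ F 0) :
    ∃ s : Series, IsConvPuiseux s ∧
      ∀ᶠ y : ℝ in 𝓝[>] 0, HasValue s y (F ((y ^ (1 / m : ℝ) : ℝ) : ℂ)) := by
  have hm' : (0 : ℚ) < m := by exact_mod_cast hm
  obtain ⟨p, hp⟩ := hF
  rw [hasFPowerSeriesAt_iff] at hp
  let φ : ℕ ↪o ℚ := OrderEmbedding.ofStrictMono (fun n : ℕ => (n : ℚ) / (m : ℚ)) fun a b hab => by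
    have : (a : ℚ) < b := by exact_mod_cast hab
    exact div_lt_div_of_pos_right this hm'
  let s : Series := HahnSeries.embDomain φ (HahnSeries.toPowerSeries.symm (PowerSeries.mk p.coeff))
  have hcoeff : ∀ n : ℕ, s.coeff ((n : ℚ) / m) = p.coeff n := by
    intro n
    have : s.coeff (φ n) = p.coeff n := by
      rw [HahnSeries.embDomain_coeff, HahnSeries.coeff_toPowerSeries_symm, PowerSeries.coeff_mk]
    exact this
  have hsupp : ∀ e ∈ s.support, ∃ n : ℕ, e = (n : ℚ) / (m : ℚ) := by
    intro e he
    by_contra hne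
    refine he (HahnSeries.embDomain_of_notMem_range ?_)
    rintro ⟨n, hn⟩
    exact hne ⟨n, hn.symm⟩
  have hev : ∀ᶠ y : ℝ in 𝓝[>] 0, HasValue s y (F ((y ^ (1 / m : ℝ) : ℝ) : ℂ)) := by
    filter_upwards [(tendsto_rpow_one_div hm).eventually hp, self_mem_nhdsWithin] with y hy hy0
    rw [← hasSum_pow_iff_hasValue hm hsupp hy0]
    simpa [hcoeff, mul_comm] using hy
  refine ⟨s, .of_eventually ⟨m, hm, fun e he => ?_⟩ (hev.mono fun _ h => h.convAt), hev⟩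
  obtain ⟨n, rfl⟩ := hsupp e he
  exact ⟨n, by simp⟩

theorem IsConvPuiseux.exists_analyticAt {m : ℕ} (hm : 0 < m) {s : Series} (hc : IsConvPuiseux s)
    (hs : ∀ e ∈ s.support, ∃ n : ℕ, e = (n : ℚ) / (m : ℚ)) :
    ∃ F : ℂ → ℂ, AnalyticAt ℂ F 0 ∧ F 0 = s.coeff 0 ∧
      ∀ᶠ y : ℝ in 𝓝[>] 0, value s y = F ((y ^ (1 / m : ℝ) : ℝ) : ℂ) := by
  obtain ⟨-, y₀, hy₀, h₀⟩ := hc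
  let a : ℕ → ℂ := fun n => s.coeff ((n : ℚ) / m)
  let F : ℂ → ℂ := fun t => ∑' n, a n * t ^ n
  have ht₀ : 0 < y₀ ^ (1 / m : ℝ) := Real.rpow_pos_of_pos hy₀ _
  have h1 := ((hasSum_pow_iff_hasValue hm hs hy₀ _).2 h₀.hasValue).summable.norm
  have hsum : ∀ t : ℂ, ‖t‖ ≤ y₀ ^ (1 / m : ℝ) → HasSum (fun n => a n * t ^ n) (F t) := by
    intro t ht
    refine (Summable.of_norm_bounded h1 fun n => ?_).hasSum
    rw [norm_mul, norm_mul, norm_pow, norm_pow, Complex.norm_real, Real.norm_of_nonneg ht₀.le]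
    gcongr
  refine ⟨F, ⟨FormalMultilinearSeries.ofScalars ℂ a, ?_⟩, ?_, ?_⟩
  · rw [hasFPowerSeriesAt_iff]
    filter_upwards [Metric.closedBall_mem_nhds (0 : ℂ) ht₀] with t ht
    have := hsum t (by simpa using ht)
    simpa [FormalMultilinearSeries.coeff_ofScalars, mul_comm] using this
  · have := hsum 0 (by simpa using ht₀.le)
    refine this.unique ?_
    convert hasSum_single 0 ?_ using 1
    · simp [a]
    · intro n hn; simp [hn]
  · filter_upwards [Ioc_mem_nhdsGT hy₀] with y hy
    refine ((hasSum_pow_iff_hasValue hm hs hy.1 _).1 (hsum _ ?_)).value_eq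
    rw [Complex.norm_real, Real.norm_of_nonneg (Real.rpow_nonneg hy.1.le _)]
    exact Real.rpow_le_rpow hy.1.le hy.2 (by positivity)

theorem exists_nat_of_hasDenom {s : Series} {m : ℕ} (hm : 0 < m) (h : HasDenom s m)
    (hpos : ∀ e ∈ s.support, 0 ≤ e) : ∀ e ∈ s.support, ∃ n : ℕ, e = (n : ℚ) / (m : ℚ) := by
  intro e he
  obtain ⟨k, rfl⟩ := h e he
  have hm' : (0 : ℚ) < m := by exact_mod_cast hm
  have hk : 0 ≤ k := by
    have := hpos _ he
    rw [le_div_iff₀ hm', zero_mul] at this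
    exact_mod_cast this
  lift k to ℕ using hk
  exact ⟨k, by simp⟩

theorem single_mul_coeff (r : ℚ) (s : Series) (e : ℚ) :
    (HahnSeries.single r (1 : ℂ) * s).coeff e = s.coeff (e - r) := by
  rw [HahnSeries.coeff_single_mul, one_mul]

/-- After removal of the leading power of `Y`, a convergent Puiseux series is an analytic function
of `y ^ (1/m)` that does not vanish at `0`; the expansion of its reciprocal is the inverse. -/
theorem IsConvPuiseux.inv {s : Series} (hs : IsConvPuiseux s) : IsConvPuiseux s⁻¹ := by
  by_cases h0 : s = 0
  · subst h0
    simpa using hs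
  have hX := isConvPuiseux_single (-s.order) 1
  obtain ⟨m, hm, hd1, hd2⟩ := hX.1.exists_common_denom hs.1
  set X : Series := HahnSeries.single (-s.order) 1 with hXdef
  have hu := hX.mul hs
  obtain ⟨F, hF, hF0, hFv⟩ := hu.exists_analyticAt hm
    (exists_nat_of_hasDenom hm (hd1.mul hd2) fun e he => by
      rw [HahnSeries.mem_support, hXdef, single_mul_coeff, sub_neg_eq_add] at he
      linarith [HahnSeries.order_le_of_coeff_ne_zero he])
  have hne : F 0 ≠ 0 := by
    rw [hF0, hXdef, single_mul_coeff, sub_neg_eq_add, zero_add]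
    exact fun h => h0 (HahnSeries.coeff_order_eq_zero.1 h)
  obtain ⟨w, hw, hwv⟩ := exists_series_of_analyticAt hm (hF.inv hne)
  have h1 : X * s * w = 1 := by
    refine (hu.mul hw).eq_of_eventually_value_eq (isConvPuiseux_single 0 1) ?_
    refine Eventually.frequently ?_
    filter_upwards [hFv, hwv, hu.eventually_hasValue, self_mem_nhdsWithin,
      (tendsto_rpow_one_div hm).eventually (hF.continuousAt.eventually_ne hne)]
      with y hy1 hy2 hy3 hy4 hy5
    rw [(hy3.mul hy4 hy2).value_eq, hy1, Pi.inv_apply, mul_inv_cancel₀ hy5]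
    exact (hasValue_one y).value_eq.symm
  have h2 : s⁻¹ = X * w := by
    refine inv_eq_of_mul_eq_one_right ?_
    rw [← h1]; ring
  rw [h2]
  exact hX.mul hw

/-- The field of convergent Puiseux series. -/
def ConvPuiseux : Subfield Series where
  carrier := {s | IsConvPuiseux s}
  mul_mem' := IsConvPuiseux.mul
  one_mem' := isConvPuiseux_single 0 1
  add_mem' := IsConvPuiseux.add
  zero_mem' := by simpa using isConvPuiseux_single 0 0
  neg_mem' := IsConvPuiseux.neg
  inv_mem' _ := IsConvPuiseux.inv

theorem isConvPuiseux_coe (s : ConvPuiseux) : IsConvPuiseux (s : Series) := s.2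

instance : CharZero ConvPuiseux :=
  have : CharZero Series :=
    charZero_of_injective_ringHom (HahnSeries.C_injective (R := ℂ) (Γ := ℚ))
  charZero_of_injective_ringHom (f := (Nat.castRingHom ConvPuiseux)) fun a b h =>
    Nat.cast_injective (R := Series) (by simpa using congrArg ConvPuiseux.subtype h)

/-! ### Factorization of polynomials with analytic coefficients -/

section LowPoly

variable {R : Type*} [CommRing R]

/-- The polynomial `∑_{i<k} u_i X^i` with prescribed coefficients. -/
def lowPoly (R : Type*) [CommRing R] (k : ℕ) : (Fin k → R) →ₗ[R] Polynomial R :=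
  ∑ i : Fin k, (Polynomial.monomial (i : ℕ)) ∘ₗ LinearMap.proj i

theorem lowPoly_apply {k : ℕ} (u : Fin k → R) :
    lowPoly R k u = ∑ i : Fin k, Polynomial.monomial (i : ℕ) (u i) := by
  simp [lowPoly]

theorem lowPoly_coeff {k : ℕ} (u : Fin k → R) (i : Fin k) : (lowPoly R k u).coeff i = u i := by
  rw [lowPoly_apply, Polynomial.finsetSum_coeff, Finset.sum_eq_single i]
  · simp
  · intro j _ hj
    rw [Polynomial.coeff_monomial, if_neg fun h => hj (Fin.ext h)]
  · simp

theorem lowPoly_degree_lt {k : ℕ} (u : Fin k → R) : (lowPoly R k u).degree < k := by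
  rw [lowPoly_apply, Polynomial.degree_lt_iff_coeff_zero]
  intro m hm
  rw [Polynomial.finsetSum_coeff]
  refine Finset.sum_eq_zero fun i _ => ?_
  rw [Polynomial.coeff_monomial, if_neg fun h => by have := i.2; omega]

theorem lowPoly_injective {k : ℕ} {u : Fin k → R} (h : lowPoly R k u = 0) : u = 0 := by
  funext i
  rw [← lowPoly_coeff u i, h]; simp

/-- The monic polynomial of degree `k` with lower coefficients `u`. -/
def monicPoly {k : ℕ} (u : Fin k → R) : Polynomial R := Polynomial.X ^ k + lowPoly R k u

theorem monicPoly_monic {k : ℕ} (u : Fin k → R) : (monicPoly u).Monic :=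
  Polynomial.monic_X_pow_add (lowPoly_degree_lt u)

theorem monicPoly_natDegree [Nontrivial R] {k : ℕ} (u : Fin k → R) :
    (monicPoly u).natDegree = k := by
  refine Polynomial.natDegree_eq_of_degree_eq_some ?_
  rw [monicPoly, Polynomial.degree_add_eq_left_of_degree_lt] <;>
    rw [Polynomial.degree_X_pow]
  exact lowPoly_degree_lt u

theorem monicPoly_coeff {k : ℕ} (u : Fin k → R) (i : Fin k) : (monicPoly u).coeff i = u i := by
  rw [monicPoly, Polynomial.coeff_add, lowPoly_coeff, Polynomial.coeff_X_pow,
    if_neg i.2.ne, zero_add]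

theorem monicPoly_of_monic {p : Polynomial R} {k : ℕ} (hp : p.Monic) (hk : p.natDegree = k) :
    monicPoly (fun i : Fin k => p.coeff i) = p := by
  nontriviality R
  ext j
  rcases lt_trichotomy j k with h | h | h
  · exact monicPoly_coeff (fun i : Fin k => p.coeff i) ⟨j, h⟩
  · subst h
    have h1 := monicPoly_monic (fun i : Fin j => p.coeff i)
    rw [Polynomial.Monic, Polynomial.leadingCoeff, monicPoly_natDegree] at h1
    rw [h1, ← hk]
    exact hp.symm
  · rw [Polynomial.coeff_eq_zero_of_natDegree_lt, Polynomial.coeff_eq_zero_of_natDegree_lt]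
    · omega
    · rw [monicPoly_natDegree]; exact h

theorem eq_of_monic_of_coeff_eq {p q : Polynomial R} {k : ℕ} (hp : p.Monic) (hq : q.Monic)
    (hpk : p.natDegree = k) (hqk : q.natDegree = k) (h : ∀ i < k, p.coeff i = q.coeff i) :
    p = q := by
  rw [← monicPoly_of_monic hp hpk, ← monicPoly_of_monic hq hqk]
  congr 1
  funext i
  exact h i i.2

end LowPoly

/-- The lower coefficients of the product of two monic polynomials, as a function of the lower
coefficients of the factors. -/
def monicMul (k l : ℕ) (x : (Fin k → ℂ) × (Fin l → ℂ)) : Fin (k + l) → ℂ :=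
  fun i => (monicPoly x.1 * monicPoly x.2).coeff i

/-- The derivative `(δu, δv) ↦ g δv + h δu` at `(g, h)` of the multiplication of monic
polynomials. -/
def monicMulDeriv (k l : ℕ) (x : (Fin k → ℂ) × (Fin l → ℂ)) :
    ((Fin k → ℂ) × (Fin l → ℂ)) →ₗ[ℂ] (Fin (k + l) → ℂ) :=
  LinearMap.pi fun i => Polynomial.lcoeff ℂ (i : ℕ) ∘ₗ
    (LinearMap.mulLeft ℂ (monicPoly x.1) ∘ₗ lowPoly ℂ l ∘ₗ LinearMap.snd ℂ _ _ +
      LinearMap.mulLeft ℂ (monicPoly x.2) ∘ₗ lowPoly ℂ k ∘ₗ LinearMap.fst ℂ _ _)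

theorem monicMulDeriv_apply (k l : ℕ) (x w : (Fin k → ℂ) × (Fin l → ℂ)) (i : Fin (k + l)) :
    monicMulDeriv k l x w i =
      (monicPoly x.1 * lowPoly ℂ l w.2 + monicPoly x.2 * lowPoly ℂ k w.1).coeff i := rfl

theorem monicMul_contDiff (k l : ℕ) : ContDiff ℂ ⊤ (monicMul k l) := by
  have h1 : ∀ a, ContDiff ℂ ⊤ fun x : (Fin k → ℂ) × (Fin l → ℂ) => (monicPoly x.1).coeff a := by
    intro a
    have : (fun x : (Fin k → ℂ) × (Fin l → ℂ) => (monicPoly x.1).coeff a) = fun x =>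
        (Polynomial.X ^ k : Polynomial ℂ).coeff a +
          (Polynomial.lcoeff ℂ a ∘ₗ lowPoly ℂ k ∘ₗ LinearMap.fst ℂ _ _).toContinuousLinearMap x :=
      rfl
    rw [this]
    exact contDiff_const.add (ContinuousLinearMap.contDiff _)
  have h2 : ∀ a, ContDiff ℂ ⊤ fun x : (Fin k → ℂ) × (Fin l → ℂ) => (monicPoly x.2).coeff a := by
    intro a
    have : (fun x : (Fin k → ℂ) × (Fin l → ℂ) => (monicPoly x.2).coeff a) = fun x =>
        (Polynomial.X ^ l : Polynomial ℂ).coeff a +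
          (Polynomial.lcoeff ℂ a ∘ₗ lowPoly ℂ l ∘ₗ LinearMap.snd ℂ _ _).toContinuousLinearMap x :=
      rfl
    rw [this]
    exact contDiff_const.add (ContinuousLinearMap.contDiff _)
  rw [contDiff_pi]
  intro i
  simp only [monicMul, Polynomial.coeff_mul]
  exact ContDiff.sum fun p _ => (h1 p.1).mul (h2 p.2)

theorem monicMul_hasStrictFDerivAt (k l : ℕ) (x : (Fin k → ℂ) × (Fin l → ℂ)) :
    HasStrictFDerivAt (monicMul k l) (monicMulDeriv k l x).toContinuousLinearMap x := by
  rw [hasStrictFDerivAt_pi']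
  intro i
  have h1 : ∀ a, HasStrictFDerivAt
      (fun x : (Fin k → ℂ) × (Fin l → ℂ) => (monicPoly x.1).coeff a)
      (Polynomial.lcoeff ℂ a ∘ₗ lowPoly ℂ k ∘ₗ LinearMap.fst ℂ _ _).toContinuousLinearMap x :=
    fun a => (HasStrictFDerivAt.const_add ((Polynomial.X ^ k : Polynomial ℂ).coeff a)
      (ContinuousLinearMap.hasStrictFDerivAt (x := x) (Polynomial.lcoeff ℂ a ∘ₗ lowPoly ℂ k ∘ₗ
        LinearMap.fst ℂ (Fin k → ℂ) (Fin l → ℂ)).toContinuousLinearMap) :)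
  have h2 : ∀ a, HasStrictFDerivAt
      (fun x : (Fin k → ℂ) × (Fin l → ℂ) => (monicPoly x.2).coeff a)
      (Polynomial.lcoeff ℂ a ∘ₗ lowPoly ℂ l ∘ₗ LinearMap.snd ℂ _ _).toContinuousLinearMap x :=
    fun a => (HasStrictFDerivAt.const_add ((Polynomial.X ^ l : Polynomial ℂ).coeff a)
      (ContinuousLinearMap.hasStrictFDerivAt (x := x) (Polynomial.lcoeff ℂ a ∘ₗ lowPoly ℂ l ∘ₗ
        LinearMap.snd ℂ (Fin k → ℂ) (Fin l → ℂ)).toContinuousLinearMap) :)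
  simp only [monicMul, Polynomial.coeff_mul]
  refine (HasStrictFDerivAt.fun_sum fun p (_ : p ∈ Finset.HasAntidiagonal.antidiagonal (i : ℕ)) =>
    (h1 p.1).mul (h2 p.2)).congr_fderiv ?_
  refine ContinuousLinearMap.ext fun w => ?_
  simp only [sum_apply, add_apply,
    smul_apply, ContinuousLinearMap.comp_apply, ContinuousLinearMap.proj_apply,
    LinearMap.coe_toContinuousLinearMap', smul_eq_mul]
  rw [monicMulDeriv_apply, Polynomial.coeff_add, mul_comm (monicPoly x.2), Polynomial.coeff_mul,
    Polynomial.coeff_mul, ← Finset.sum_add_distrib]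
  refine Finset.sum_congr rfl fun p _ => ?_
  simp only [LinearMap.comp_apply, Polynomial.lcoeff_apply, LinearMap.fst_apply,
    LinearMap.snd_apply]
  ring

/-- If `g` and `h` are coprime, then `g δv + h δu = 0` with `deg δu < deg g`, `deg δv < deg h`
forces `δu = δv = 0`. -/
theorem monicMulDeriv_injective {k l : ℕ} {x : (Fin k → ℂ) × (Fin l → ℂ)}
    (hx : IsCoprime (monicPoly x.1) (monicPoly x.2)) :
    Function.Injective (monicMulDeriv k l x) := by
  rw [← LinearMap.ker_eq_bot, LinearMap.ker_eq_bot']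
  intro w hw
  set g := monicPoly x.1
  set h := monicPoly x.2
  have hgdeg : g.degree = k := by
    rw [Polynomial.degree_eq_natDegree (monicPoly_monic x.1).ne_zero, monicPoly_natDegree]
  have hhdeg : h.degree = l := by
    rw [Polynomial.degree_eq_natDegree (monicPoly_monic x.2).ne_zero, monicPoly_natDegree]
  have hzero : g * lowPoly ℂ l w.2 + h * lowPoly ℂ k w.1 = 0 := by
    have hdeg : (g * lowPoly ℂ l w.2 + h * lowPoly ℂ k w.1).degree < ((k + l : ℕ) : WithBot ℕ) := by
      refine (Polynomial.degree_add_le _ _).trans_lt (max_lt ?_ ?_)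
      · rw [Polynomial.degree_mul, hgdeg, Nat.cast_add]
        exact WithBot.add_lt_add_left (by simp) (lowPoly_degree_lt _)
      · rw [Polynomial.degree_mul, hhdeg, Nat.cast_add, add_comm]
        exact WithBot.add_lt_add_right (by simp) (lowPoly_degree_lt _)
    ext j
    by_cases hj : j < k + l
    · exact congrFun hw ⟨j, hj⟩
    · rw [Polynomial.coeff_zero]
      exact (Polynomial.degree_lt_iff_coeff_zero _ _).1 hdeg j (not_lt.1 hj)
  have hu : lowPoly ℂ k w.1 = 0 := by
    refine Polynomial.eq_zero_of_dvd_of_degree_lt (p := g) (hx.dvd_of_dvd_mul_left ?_) ?_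
    · exact (dvd_add_right (dvd_mul_right g _)).1 (hzero ▸ dvd_zero g)
    · rw [hgdeg]; exact lowPoly_degree_lt _
  have hv : lowPoly ℂ l w.2 = 0 := by
    rw [hu, mul_zero, add_zero] at hzero
    exact (mul_eq_zero.1 hzero).resolve_left (monicPoly_monic x.1).ne_zero
  exact Prod.ext (lowPoly_injective hu) (lowPoly_injective hv)

/-- Hensel's lemma for analytic coefficients: a factorization into coprime monic factors at `t = 0`
extends to one with coefficients analytic near `0`. By coprimality the multiplication of monic
polynomials has an invertible derivative, so that the inverse function theorem applies. -/
theorem exists_analytic_factorization {k l : ℕ} {F : Fin (k + l) → ℂ → ℂ}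
    (hF : ∀ i, AnalyticAt ℂ (F i) 0) {u : Fin k → ℂ} {v : Fin l → ℂ}
    (hcop : IsCoprime (monicPoly u) (monicPoly v))
    (h0 : monicPoly (fun i => F i 0) = monicPoly u * monicPoly v) :
    ∃ (U : Fin k → ℂ → ℂ) (V : Fin l → ℂ → ℂ), (∀ i, AnalyticAt ℂ (U i) 0) ∧
      (∀ i, AnalyticAt ℂ (V i) 0) ∧ ∀ᶠ t in 𝓝 0, monicPoly (fun i => F i t) =
        monicPoly (fun i => U i t) * monicPoly (fun i => V i t) := by
  have hinj := monicMulDeriv_injective (x := (u, v)) hcop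
  let e := (LinearEquiv.ofInjectiveOfFinrankEq (monicMulDeriv k l (u, v)) hinj
    (by simp)).toContinuousLinearEquiv
  have hd : HasStrictFDerivAt (monicMul k l)
      (e : ((Fin k → ℂ) × (Fin l → ℂ)) →L[ℂ] (Fin (k + l) → ℂ)) (u, v) :=
    monicMul_hasStrictFDerivAt k l (u, v)
  let inv := hd.localInverse (monicMul k l) e (u, v)
  have hval : monicMul k l (u, v) = fun i => F i 0 := by
    funext i
    rw [monicMul, ← h0, monicPoly_coeff]
  have hinv : ContDiffAt ℂ ⊤ inv (fun i => F i 0) := by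
    rw [← hval]
    exact ContDiffAt.to_localInverse ((monicMul_contDiff k l).contDiffAt) hd.hasFDerivAt (by simp)
  have hFa : ContDiffAt ℂ ⊤ (fun t i => F i t) 0 := by
    rw [contDiffAt_pi]
    exact fun i => (hF i).contDiffAt
  have hcomp : ContDiffAt ℂ ⊤ (fun t => inv fun i => F i t) 0 := hinv.comp 0 hFa
  refine ⟨fun i t => (inv fun i => F i t).1 i, fun i t => (inv fun i => F i t).2 i,
    fun i => ?_, fun i => ?_, ?_⟩
  · exact (contDiffAt_pi.1 hcomp.fst i).analyticAt
  · exact (contDiffAt_pi.1 hcomp.snd i).analyticAt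
  · have hr := hd.eventually_right_inverse
    rw [hval] at hr
    filter_upwards [hFa.continuousAt.tendsto.eventually hr] with t ht
    refine eq_of_monic_of_coeff_eq (k := k + l) (monicPoly_monic _)
      ((monicPoly_monic _).mul (monicPoly_monic _)) (monicPoly_natDegree _) ?_ fun i hi => ?_
    · rw [(monicPoly_monic _).natDegree_mul (monicPoly_monic _), monicPoly_natDegree,
        monicPoly_natDegree]
    · have := congrFun ht ⟨i, hi⟩
      rw [show i = ((⟨i, hi⟩ : Fin (k + l)) : ℕ) from rfl, monicPoly_coeff, ← this]
      rfl

/-! ### Evaluation of polynomials with convergent coefficients -/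

/-- The complex polynomial obtained from `p` by evaluation of its coefficients at `y`. -/
def valuePoly (p : Polynomial ConvPuiseux) (y : ℝ) : Polynomial ℂ :=
  ∑ i ∈ Finset.range (p.natDegree + 1), Polynomial.monomial i (value (p.coeff i : Series) y)

theorem value_zero (y : ℝ) : value 0 y = 0 := (hasValue_zero y).value_eq

theorem valuePoly_coeff (p : Polynomial ConvPuiseux) (y : ℝ) (i : ℕ) :
    (valuePoly p y).coeff i = value (p.coeff i : Series) y := by
  rw [valuePoly, Polynomial.finsetSum_coeff]
  simp only [Polynomial.coeff_monomial, Finset.sum_ite_eq', Finset.mem_range]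
  split_ifs with h
  · rfl
  · rw [Polynomial.coeff_eq_zero_of_natDegree_lt (by omega)]
    exact (value_zero y).symm

theorem eventually_coeff_hasValue (p : Polynomial ConvPuiseux) :
    ∀ᶠ y : ℝ in 𝓝[>] 0, ∀ i, HasValue (p.coeff i : Series) y ((valuePoly p y).coeff i) := by
  have : ∀ᶠ y : ℝ in 𝓝[>] 0, ∀ i ∈ Finset.range (p.natDegree + 1),
      ConvAt (p.coeff i : Series) y := by
    rw [Filter.eventually_all_finset]
    exact fun i _ => (isConvPuiseux_coe (p.coeff i)).eventually_convAt
  filter_upwards [this] with y hy i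
  rw [valuePoly_coeff]
  by_cases hi : i ∈ Finset.range (p.natDegree + 1)
  · exact (hy i hi).hasValue
  · rw [Polynomial.coeff_eq_zero_of_natDegree_lt (by simpa using hi)]
    exact (value_zero y).symm ▸ hasValue_zero y

theorem hasValue_sum {ι : Type*} (A : Finset ι) {s : ι → Series} {y : ℝ} {z : ι → ℂ}
    (h : ∀ i ∈ A, HasValue (s i) y (z i)) : HasValue (∑ i ∈ A, s i) y (∑ i ∈ A, z i) := by
  classical
  induction A using Finset.induction_on with
  | empty => simpa using hasValue_zero y
  | insert a A ha ih =>
    rw [Finset.sum_insert ha, Finset.sum_insert ha]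
    exact (h a (Finset.mem_insert_self a A)).add
      (ih fun i hi => h i (Finset.mem_insert_of_mem hi))

theorem coe_coeff_mul (p q : Polynomial ConvPuiseux) (n : ℕ) :
    ((p * q).coeff n : Series) = ∑ x ∈ Finset.HasAntidiagonal.antidiagonal n,
      (p.coeff x.1 : Series) * (q.coeff x.2 : Series) := by
  rw [Polynomial.coeff_mul, ← Subfield.subtype_apply, map_sum]
  simp only [map_mul, Subfield.subtype_apply]

theorem valuePoly_mul {p q : Polynomial ConvPuiseux} {y : ℝ} (hy : 0 < y)
    (hp : ∀ i, HasValue (p.coeff i : Series) y ((valuePoly p y).coeff i))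
    (hq : ∀ i, HasValue (q.coeff i : Series) y ((valuePoly q y).coeff i)) :
    valuePoly (p * q) y = valuePoly p y * valuePoly q y := by
  ext n
  rw [valuePoly_coeff, coe_coeff_mul, Polynomial.coeff_mul]
  exact HasValue.value_eq (hasValue_sum _ fun x _ => (hp x.1).mul hy (hq x.2))

theorem eventually_pos : ∀ᶠ y : ℝ in 𝓝[>] 0, 0 < y := self_mem_nhdsWithin

theorem eventually_valuePoly_mul (p q : Polynomial ConvPuiseux) :
    ∀ᶠ y : ℝ in 𝓝[>] 0, valuePoly (p * q) y = valuePoly p y * valuePoly q y := by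
  filter_upwards [eventually_coeff_hasValue p, eventually_coeff_hasValue q, eventually_pos]
    with y hp hq hy using valuePoly_mul hy hp hq

theorem eq_of_frequently_valuePoly_eq {p q : Polynomial ConvPuiseux}
    (h : ∃ᶠ y : ℝ in 𝓝[>] 0, valuePoly p y = valuePoly q y) : p = q := by
  refine Polynomial.ext fun i => Subtype.ext ?_
  refine (isConvPuiseux_coe (p.coeff i)).eq_of_eventually_value_eq
    (isConvPuiseux_coe (q.coeff i)) ?_
  refine h.mono fun y hy => ?_
  rw [← valuePoly_coeff, ← valuePoly_coeff, hy]

theorem valuePoly_monicPoly {k : ℕ} (u : Fin k → ConvPuiseux) (y : ℝ) :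
    valuePoly (monicPoly u) y = monicPoly fun i => value (u i : Series) y := by
  ext j
  rw [valuePoly_coeff]
  rcases lt_trichotomy j k with h | h | h
  · rw [show j = ((⟨j, h⟩ : Fin k) : ℕ) from rfl, monicPoly_coeff, monicPoly_coeff]
  · subst h
    have h1 := monicPoly_monic u
    have h2 := monicPoly_monic fun i => value (u i : Series) y
    rw [Polynomial.Monic, Polynomial.leadingCoeff, monicPoly_natDegree] at h1 h2
    rw [h1, h2]
    exact (hasValue_one y).value_eq
  · rw [Polynomial.coeff_eq_zero_of_natDegree_lt, Polynomial.coeff_eq_zero_of_natDegree_lt]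
    · exact value_zero y
    · rw [monicPoly_natDegree]; exact h
    · rw [monicPoly_natDegree]; exact h

/-! ### The Newton–Puiseux theorem -/

theorem exists_common_denom {k : ℕ} (u : Fin k → ConvPuiseux) :
    ∃ m : ℕ, 0 < m ∧ ∀ i, HasDenom (u i : Series) m := by
  choose m hm hu using fun i => (isConvPuiseux_coe (u i)).1
  refine ⟨∏ i, m i, Finset.prod_pos fun i _ => hm i, fun i => ?_⟩
  exact HasDenom.of_dvd (hu i) (Finset.dvd_prod_of_mem m (Finset.mem_univ i))
    (Finset.prod_pos fun i _ => hm i)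

/-- Hensel's lemma for convergent Puiseux series: a coprime factorization of the constant terms
lifts. -/
theorem ConvPuiseux.exists_factorization {k l : ℕ} {a : Fin (k + l) → ConvPuiseux}
    (hpos : ∀ i, ∀ e ∈ (a i : Series).support, 0 ≤ e) {u : Fin k → ℂ} {v : Fin l → ℂ}
    (hcop : IsCoprime (monicPoly u) (monicPoly v))
    (h0 : monicPoly (fun i => (a i : Series).coeff 0) = monicPoly u * monicPoly v) :
    ∃ (b : Fin k → ConvPuiseux) (c : Fin l → ConvPuiseux),
      monicPoly a = monicPoly b * monicPoly c := by
  obtain ⟨m, hm, hd⟩ := exists_common_denom a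
  choose F hF hF0 hFv using fun i => (isConvPuiseux_coe (a i)).exists_analyticAt hm
    (exists_nat_of_hasDenom hm (hd i) (hpos i))
  obtain ⟨U, V, hU, hV, hUV⟩ := exists_analytic_factorization hF hcop (by simpa only [hF0] using h0)
  choose b hb hbv using fun i => exists_series_of_analyticAt hm (hU i)
  choose c hc hcv using fun i => exists_series_of_analyticAt hm (hV i)
  refine ⟨fun i => ⟨b i, hb i⟩, fun i => ⟨c i, hc i⟩, ?_⟩
  refine eq_of_frequently_valuePoly_eq (Eventually.frequently ?_)
  filter_upwards [eventually_valuePoly_mul (monicPoly fun i => (⟨b i, hb i⟩ : ConvPuiseux))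
    (monicPoly fun i => (⟨c i, hc i⟩ : ConvPuiseux)), (tendsto_rpow_one_div hm).eventually hUV,
    Filter.eventually_all.2 hFv, Filter.eventually_all.2 hbv, Filter.eventually_all.2 hcv]
    with y h1 h2 h3 h4 h5
  rw [h1, valuePoly_monicPoly, valuePoly_monicPoly, valuePoly_monicPoly]
  simp only [h3, (h4 _).value_eq, (h5 _).value_eq]
  exact h2

/-- Over a field of characteristic zero the coefficient after the leading one can be removed by a
translation of the variable. -/
theorem exists_taylor_coeff_eq_zero {R : Type*} [Field R] [CharZero R] {P : Polynomial R} {n : ℕ}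
    (hP : P.Monic) (hn : P.natDegree = n + 1) : ∃ r, (Polynomial.taylor r P).coeff n = 0 := by
  have hlead : P.coeff (n + 1) = 1 := by rw [← hn]; exact hP
  have hn0 : ((n : R) + 1) ≠ 0 := by exact_mod_cast n.succ_ne_zero
  refine ⟨-P.coeff n / (n + 1), ?_⟩
  have hdeg : (Polynomial.hasseDeriv n P).natDegree < 2 :=
    (Polynomial.natDegree_hasseDeriv_le P n).trans_lt (by omega)
  rw [Polynomial.taylor_coeff, Polynomial.eval_eq_sum_range' hdeg]
  simp only [Finset.sum_range_succ, Finset.sum_range_zero, Polynomial.hasseDeriv_coeff, zero_add,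
    Nat.choose_self, add_comm 1 n, Nat.choose_succ_self_right, hlead]
  push_cast
  field_simp
  ring

/-- A monic complex polynomial with vanishing next-to-leading coefficient that is not a power of `X`
is a product of two coprime monic polynomials of smaller degree. -/
theorem exists_coprime_factorization {P : Polynomial ℂ} {n : ℕ} (hP : P.Monic)
    (hn : P.natDegree = n + 1) (hnext : P.coeff n = 0) (hne : P ≠ Polynomial.X ^ (n + 1)) :
    ∃ g h : Polynomial ℂ, g.Monic ∧ h.Monic ∧ 0 < g.natDegree ∧ 0 < h.natDegree ∧
      IsCoprime g h ∧ P = g * h := by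
  obtain ⟨c, hc⟩ := IsAlgClosed.exists_root P (by
    rw [Polynomial.degree_eq_natDegree hP.ne_zero, hn]
    exact_mod_cast n.succ_ne_zero)
  obtain ⟨h, hPh, hdvd⟩ := P.exists_eq_pow_rootMultiplicity_mul_and_not_dvd hP.ne_zero c
  set e := P.rootMultiplicity c
  have he : 0 < e := (Polynomial.rootMultiplicity_pos hP.ne_zero).2 hc
  have hg : ((Polynomial.X - Polynomial.C c) ^ e).Monic := (Polynomial.monic_X_sub_C c).pow e
  have hh : h.Monic := hg.of_mul_monic_left (hPh ▸ hP)
  have hgdeg : ((Polynomial.X - Polynomial.C c) ^ e).natDegree = e := by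
    rw [Polynomial.natDegree_pow, Polynomial.natDegree_X_sub_C, mul_one]
  refine ⟨_, h, hg, hh, by rwa [hgdeg], ?_, ?_, hPh⟩
  · by_contra hdeg
    have h1 : h = 1 := hh.natDegree_eq_zero.1 (by omega)
    rw [h1, mul_one] at hPh
    have hen : e = n + 1 := by rw [← hn, ← hgdeg, ← hPh]
    have h2 : P.nextCoeff = e • (-c) := by
      rw [hPh, (Polynomial.monic_X_sub_C c).nextCoeff_pow, Polynomial.nextCoeff_X_sub_C]
    rw [Polynomial.nextCoeff_of_natDegree_pos (by omega), hn, Nat.add_sub_cancel, hnext,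
      nsmul_eq_mul, eq_comm, mul_eq_zero] at h2
    have hc0 : c = 0 := by
      rcases h2 with h2 | h2
      · exact absurd h2 (by exact_mod_cast he.ne')
      · exact neg_eq_zero.1 h2
    apply hne
    rw [hPh, hc0, Polynomial.C_0, sub_zero, hen]
  · exact (((Polynomial.irreducible_X_sub_C c).coprime_iff_not_dvd).2 hdvd).pow_left

/-- The slope `r` of the Newton polygon: after the substitution `X ↦ Y^r X` all coefficients have
nonnegative exponents, and some lower coefficient has a nonzero constant term. -/
theorem exists_newton_slope {P : Polynomial ConvPuiseux} {n : ℕ} (hn : P.natDegree = n)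
    (hne : ∃ i < n, P.coeff i ≠ 0) :
    ∃ r : ℚ, (∀ i < n, ∀ e ∈ ((P.scaleRoots ⟨HahnSeries.single (-r) 1,
        isConvPuiseux_single _ _⟩).coeff i : Series).support, 0 ≤ e) ∧
      ∃ i < n, ((P.scaleRoots ⟨HahnSeries.single (-r) 1,
        isConvPuiseux_single _ _⟩).coeff i : Series).coeff 0 ≠ 0 := by
  classical
  let ord : ℕ → ℚ := fun i => (P.coeff i : Series).order / ((n : ℚ) - i)
  obtain ⟨i₀, hi₀, hmin⟩ := Finset.exists_min_image
    ((Finset.range n).filter fun i => P.coeff i ≠ 0) ord (by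
      obtain ⟨i, hi, hi'⟩ := hne
      exact ⟨i, by simp [hi, hi']⟩)
  rw [Finset.mem_filter, Finset.mem_range] at hi₀
  have hcoeff : ∀ i < n, ∀ e, ((P.scaleRoots ⟨HahnSeries.single (-ord i₀) 1,
        isConvPuiseux_single _ _⟩).coeff i : Series).coeff e =
      (P.coeff i : Series).coeff (e + ((n : ℚ) - i) * ord i₀) := by
    intro i hi e
    rw [Polynomial.coeff_scaleRoots, hn]
    push_cast
    rw [HahnSeries.single_pow, one_pow, mul_comm, single_mul_coeff, nsmul_eq_mul,
      Nat.cast_sub hi.le]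
    congr 1
    ring
  refine ⟨ord i₀, fun i hi e he => ?_, i₀, hi₀.1, ?_⟩
  · rw [HahnSeries.mem_support, hcoeff i hi] at he
    have h1 := HahnSeries.order_le_of_coeff_ne_zero he
    have hne : P.coeff i ≠ 0 := by
      intro h
      rw [h] at he
      exact he rfl
    have h2 := hmin i (by simp [hi, hne])
    have hpos : (0 : ℚ) < (n : ℚ) - i := by
      rw [sub_pos]; exact_mod_cast hi
    have h3 : ord i * ((n : ℚ) - i) = (P.coeff i : Series).order := div_mul_cancel₀ _ hpos.ne'
    nlinarith
  · rw [hcoeff i₀ hi₀.1, zero_add]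
    have hpos : (0 : ℚ) < (n : ℚ) - i₀ := by
      rw [sub_pos]; exact_mod_cast hi₀.1
    rw [mul_comm, div_mul_cancel₀ _ hpos.ne']
    intro h
    rw [HahnSeries.coeff_order_eq_zero] at h
    exact hi₀.2 (Subtype.ext h)

theorem ConvPuiseux.exists_root (n : ℕ) : ∀ P : Polynomial ConvPuiseux, P.Monic →
    P.natDegree = n + 1 → ∃ z, P.IsRoot z := by
  induction n using Nat.strong_induction_on with
  | _ n ih =>
  intro P hP hn
  obtain ⟨c, hc⟩ := exists_taylor_coeff_eq_zero hP hn
  set P₁ := Polynomial.taylor c P with hP₁def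
  have hP₁ : P₁.Monic := by
    rw [Polynomial.Monic, Polynomial.leadingCoeff_taylor]; exact hP
  have hn₁ : P₁.natDegree = n + 1 := by rw [Polynomial.natDegree_taylor, hn]
  suffices ∃ z, P₁.IsRoot z by
    obtain ⟨z, hz⟩ := this
    exact ⟨z + c, by rw [Polynomial.IsRoot, ← Polynomial.taylor_eval]; exact hz⟩
  by_cases hall : ∃ i < n + 1, P₁.coeff i ≠ 0
  swap
  · push Not at hall
    exact ⟨0, by rw [Polynomial.IsRoot, ← Polynomial.coeff_zero_eq_eval_zero, hall 0 n.succ_pos]⟩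
  obtain ⟨r, hpos, i₀, hi₀, hne⟩ := exists_newton_slope hn₁ hall
  set Z : ConvPuiseux := ⟨HahnSeries.single (-r) 1, isConvPuiseux_single _ _⟩ with hZ
  have hZ0 : Z ≠ 0 := by
    intro h
    have := congrArg (Subtype.val) h
    exact HahnSeries.single_ne_zero one_ne_zero this
  set P₂ := P₁.scaleRoots Z
  have hP₂ : P₂.Monic := (Polynomial.monic_scaleRoots_iff Z).2 hP₁
  have hn₂ : P₂.natDegree = n + 1 := by rw [Polynomial.natDegree_scaleRoots, hn₁]
  suffices ∃ z, P₂.IsRoot z by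
    obtain ⟨z, hz⟩ := this
    refine ⟨Z⁻¹ * z, ?_⟩
    have h1 : P₂.scaleRoots Z⁻¹ = P₁ := by
      rw [← Polynomial.scaleRoots_mul, mul_inv_cancel₀ hZ0, Polynomial.scaleRoots_one]
    rw [Polynomial.IsRoot, ← h1, Polynomial.scaleRoots_eval_mul, hz.eq_zero, mul_zero]
  set P₀ : Polynomial ℂ := monicPoly fun i : Fin (n + 1) => (P₂.coeff i : Series).coeff 0 with hP₀
  obtain ⟨g, h, hg, hh, hg0, hh0, hcop, hgh⟩ := exists_coprime_factorization
    (P := P₀) (n := n) (monicPoly_monic _) (monicPoly_natDegree _)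
    (by
      rw [hP₀, show n = ((⟨n, n.lt_succ_self⟩ : Fin (n + 1)) : ℕ) from rfl, monicPoly_coeff]
      change (P₂.coeff n : Series).coeff 0 = 0
      rw [Polynomial.coeff_scaleRoots, hc, zero_mul]
      rfl)
    (by
      intro h
      have := congrArg (fun p => p.coeff i₀) h
      simp only [Polynomial.coeff_X_pow, if_neg hi₀.ne] at this
      rw [hP₀, show i₀ = ((⟨i₀, hi₀⟩ : Fin (n + 1)) : ℕ) from rfl, monicPoly_coeff] at this
      exact hne this)
  obtain ⟨k, hk⟩ : ∃ k, g.natDegree = k := ⟨_, rfl⟩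
  obtain ⟨l, hl⟩ : ∃ l, h.natDegree = l := ⟨_, rfl⟩
  have hkl : n + 1 = k + l := by
    rw [← hk, ← hl, ← hg.natDegree_mul hh, ← hgh, hP₀, monicPoly_natDegree]
  rw [← monicPoly_of_monic hP₂ hn₂]
  rw [← monicPoly_of_monic hg hk, ← monicPoly_of_monic hh hl] at hgh hcop
  clear_value P₂
  have hfac : ∃ (b : Fin k → ConvPuiseux) (c : Fin l → ConvPuiseux),
      (monicPoly fun i : Fin (n + 1) => P₂.coeff i) = monicPoly b * monicPoly c := by
    rw [hkl] at hpos hP₀ ⊢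
    exact ConvPuiseux.exists_factorization (fun i => hpos i i.2) hcop (hP₀ ▸ hgh)
  obtain ⟨b, c, hbc⟩ := hfac
  obtain ⟨z, hz⟩ := ih (k - 1) (by omega) (monicPoly b) (monicPoly_monic b)
    (by rw [monicPoly_natDegree]; omega)
  exact ⟨z, by rw [hbc]; exact Polynomial.root_mul_right_of_isRoot _ hz⟩

/-- The field of convergent Puiseux series is algebraically closed. -/
instance : IsAlgClosed ConvPuiseux :=
  IsAlgClosed.of_exists_root _ fun P hP hirr => by
    obtain ⟨z, hz⟩ := ConvPuiseux.exists_root (P.natDegree - 1) P hP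
      (by have := hirr.natDegree_pos; omega)
    exact ⟨z, hz⟩

/-! ### Puiseux expansions of algebraic functions -/

theorem polyToSeries_monomial (n : ℕ) (a : ℚ) :
    polyToSeries (Polynomial.monomial n a) = HahnSeries.single (n : ℚ) (a : ℂ) := by
  rw [← Polynomial.C_mul_X_pow_eq_monomial]
  simp only [polyToSeries, RingHom.comp_apply, Polynomial.coe_mapRingHom, Polynomial.map_C,
    Polynomial.map_X, map_mul, map_pow,
    Polynomial.coeToPowerSeries.ringHom_apply, Polynomial.coe_C, Polynomial.coe_X,
    HahnSeries.ofPowerSeries_C, HahnSeries.ofPowerSeries_X, HahnSeries.C_apply,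
    HahnSeries.single_pow, HahnSeries.single_mul_single]
  simp

theorem hasValue_polyToSeries (p : Polynomial ℚ) (y : ℝ) :
    HasValue (polyToSeries p) y (p.eval₂ (algebraMap ℚ ℂ) (y : ℂ)) := by
  induction p using Polynomial.induction_on' with
  | add p q hp hq =>
    rw [map_add, Polynomial.eval₂_add]
    exact hp.add hq
  | monomial n a =>
    rw [polyToSeries_monomial, Polynomial.eval₂_monomial]
    convert hasValue_single (n : ℚ) (a : ℂ) y using 2
    · simp
    · rw [Rat.cast_natCast, Real.rpow_natCast, Complex.ofReal_pow]

theorem polyToSeries_mem (p : Polynomial ℚ) : polyToSeries p ∈ ConvPuiseux := by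
  induction p using Polynomial.induction_on' with
  | add p q hp hq =>
    rw [map_add]
    exact add_mem hp hq
  | monomial n a =>
    rw [polyToSeries_monomial]
    exact isConvPuiseux_single _ _

theorem toSeries_algebraMap (p : Polynomial ℚ) :
    toSeries (algebraMap (Polynomial ℚ) K p) = polyToSeries p := by
  simp [toSeries]

theorem toSeries_mem (a : K) : toSeries a ∈ ConvPuiseux := by
  induction a using RatFunc.induction_on with
  | f p q hq =>
    rw [map_div₀, toSeries_algebraMap, toSeries_algebraMap]
    exact div_mem (polyToSeries_mem p) (polyToSeries_mem q)

/-- The expansion at `Y = 0` of a rational function, as a convergent Puiseux series. -/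
def toConvPuiseux : K →+* ConvPuiseux := toSeries.codRestrict ConvPuiseux toSeries_mem

/-- An embedding over `ℚ(Y)` of the algebraic closure of `ℚ(Y)` into the field of convergent Puiseux
series. -/
def embed : L →+* ConvPuiseux :=
  letI : Algebra K ConvPuiseux := toConvPuiseux.toAlgebra
  (IsAlgClosed.lift (R := K) (S := L) (M := ConvPuiseux)).toRingHom

theorem embed_algebraMap (a : K) : embed (algebraMap K L a) = toConvPuiseux a := by
  let : Algebra K ConvPuiseux := toConvPuiseux.toAlgebra
  exact (IsAlgClosed.lift (R := K) (S := L) (M := ConvPuiseux)).commutes a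

/-- The Puiseux expansion of an algebraic function. -/
def expand : L →+* Series := ConvPuiseux.subtype.comp embed

theorem expand_apply (z : L) : expand z = (embed z : Series) := rfl

theorem isConvPuiseux_expand (z : L) : IsConvPuiseux (expand z) := (embed z).2

theorem expand_comp_algebraMap : expand.comp (algebraMap K L) = toSeries := by
  ext1 a
  rw [RingHom.comp_apply, expand_apply, embed_algebraMap]
  rfl

theorem expand_injective : Function.Injective expand := expand.injective

theorem roots_map_toSeries (g : Polynomial K) :
    (g.map toSeries).roots = (g.aroots L).map expand := by
  have h := Polynomial.roots_map_of_injective_of_card_eq_natDegree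
    (p := g.map (algebraMap K L)) (f := expand) expand_injective
    (IsAlgClosed.card_roots_eq_natDegree)
  rw [Polynomial.map_map, expand_comp_algebraMap] at h
  exact h.symm

open Classical in
/-- Newton–Puiseux: the Puiseux expansions of the roots of `g` are the images of all roots of `g` in
an algebraic closure. -/
theorem puiseuxRoots_eq (g : Polynomial K) : puiseuxRoots g = (g.aroots L).map expand := by
  rw [puiseuxRoots, roots_map_toSeries, Multiset.filter_eq_self]
  intro s hs
  obtain ⟨z, -, rfl⟩ := Multiset.mem_map.1 hs
  exact (isConvPuiseux_expand z).1

theorem conjSeries_comp_toSeries : conjSeries.comp toSeries = toSeries := by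
  refine IsLocalization.ringHom_ext (nonZeroDivisors (Polynomial ℚ)) (RingHom.ext fun p => ?_)
  simp only [RingHom.comp_apply, toSeries_algebraMap]
  induction p using Polynomial.induction_on' with
  | add p q hp hq => rw [map_add, map_add, hp, hq]
  | monomial n a =>
    rw [polyToSeries_monomial]
    ext e
    rw [conjSeries_coeff, HahnSeries.coeff_single]
    split_ifs <;> simp

/-- The roots of a polynomial over `ℚ(Y)` are stable under complex conjugation of the coefficients
of their expansions. -/
theorem exists_conj_root {g : Polynomial K} {z : L} (hz : z ∈ g.aroots L) :
    ∃ z' ∈ g.aroots L, expand z' = conjSeries (expand z) := by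
  have h1 : expand z ∈ (g.map toSeries).roots := by
    rw [roots_map_toSeries]
    exact Multiset.mem_map_of_mem _ hz
  have h2 : conjSeries (expand z) ∈ (g.map toSeries).roots := by
    rw [Polynomial.mem_roots'] at h1 ⊢
    refine ⟨h1.1, ?_⟩
    rw [Polynomial.IsRoot, ← conjSeries_comp_toSeries, ← Polynomial.map_map,
      Polynomial.eval_map_apply, h1.2.eq_zero, map_zero]
  rw [roots_map_toSeries] at h2
  exact Multiset.mem_map.1 h2

/-! ### Roots of the square-free factors -/

theorem nodup_aroots_of_squarefree {g : Polynomial K} (hg : Squarefree g) :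
    (g.aroots L).Nodup := by
  have h1 : g.Separable := PerfectField.separable_iff_squarefree.2 hg
  exact Polynomial.nodup_roots h1.map

theorem disjoint_aroots_of_isCoprime {g h : Polynomial K} (hgh : IsCoprime g h) {z : L}
    (hg : z ∈ g.aroots L) (hh : z ∈ h.aroots L) : False := by
  obtain ⟨a, b, hab⟩ := hgh
  have := congrArg (Polynomial.aeval z) hab
  simp [(Polynomial.mem_aroots.1 hg).2, (Polynomial.mem_aroots.1 hh).2] at this

theorem aroots_eq_sum_squarefreeFactor {T : Polynomial K} (hT : T ≠ 0) :
    T.aroots L = ∑ i ∈ Finset.Icc 1 T.natDegree, i • (squarefreeFactor T i).aroots L := by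
  have hspec := (squarefreeFactor_spec T hT).1
  have hlc : T.leadingCoeff ≠ 0 := Polynomial.leadingCoeff_ne_zero.2 hT
  have hprod : ∏ i ∈ Finset.Icc 1 T.natDegree, squarefreeFactor T i ^ i ≠ 0 := by
    intro h
    rw [h, mul_zero] at hspec
    exact hT hspec
  conv_lhs => rw [hspec]
  rw [Polynomial.aroots_C_mul _ hlc, Polynomial.aroots_def, Polynomial.map_prod,
    Polynomial.roots_prod]
  · rw [Multiset.bind, Multiset.join, ← Finset.sum]
    refine Finset.sum_congr rfl fun i _ => ?_
    rw [Polynomial.map_pow, Polynomial.roots_pow]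
  · rw [← Polynomial.map_prod]
    exact (Polynomial.map_ne_zero_iff (algebraMap K L).injective).2 hprod

theorem count_aroots_of_mem_squarefreeFactor [DecidableEq L] {T : Polynomial K} (hT : T ≠ 0) {i : ℕ}
    (hi : i ∈ Finset.Icc 1 T.natDegree) {z : L} (hz : z ∈ (squarefreeFactor T i).aroots L) :
    (T.aroots L).count z = i := by
  rw [aroots_eq_sum_squarefreeFactor hT, Multiset.count_sum', Finset.sum_eq_single i]
  · rw [Multiset.count_nsmul, Multiset.count_eq_one_of_mem
      (nodup_aroots_of_squarefree ((squarefreeFactor_spec T hT).2.1 i)) hz, mul_one]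
  · intro j _ hji
    rw [Multiset.count_nsmul, Multiset.count_eq_zero_of_notMem, mul_zero]
    exact fun hj => disjoint_aroots_of_isCoprime ((squarefreeFactor_spec T hT).2.2 j i hji) hj hz
  · exact fun h => absurd hi h

/-- The entries of the list of truncated expansions are indexed by the distinct roots of `T`; the
index attached to a root is its multiplicity. -/
theorem truncatedRoots_eq [DecidableEq L] {T : Polynomial K} (hT : T ≠ 0) (N : ℕ) :
    truncatedRoots T N = (T.aroots L).dedup.map fun z =>
      ((T.aroots L).count z, HahnSeries.truncLT (N : ℚ) (expand z)) := by
  have hbind : (T.aroots L).dedup =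
      (Finset.Icc 1 T.natDegree).val.bind fun i => (squarefreeFactor T i).aroots L := by
    refine (Multiset.Nodup.ext (Multiset.nodup_dedup _) ?_).2 fun z => ?_
    · refine Multiset.nodup_bind.2 ⟨fun i _ =>
        nodup_aroots_of_squarefree ((squarefreeFactor_spec T hT).2.1 i), ?_⟩
      refine Multiset.Nodup.pairwise (fun i _ j _ hij => ?_) (Finset.nodup _)
      rw [Function.onFun, Multiset.disjoint_left]
      exact fun {z} hz hz' =>
        disjoint_aroots_of_isCoprime ((squarefreeFactor_spec T hT).2.2 i j hij) hz hz'
    · rw [Multiset.mem_dedup, Multiset.mem_bind, aroots_eq_sum_squarefreeFactor hT,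
        Multiset.mem_sum]
      refine exists_congr fun i => and_congr_right fun hi => ?_
      have : i ≠ 0 := by have := (Finset.mem_Icc.1 hi).1; omega
      exact Multiset.mem_nsmul_of_ne_zero this
  rw [hbind, Multiset.map_bind, truncatedRoots]
  refine Multiset.bind_congr fun i hi => ?_
  rw [puiseuxRoots_eq, Multiset.map_map]
  refine Multiset.map_congr rfl fun z hz => ?_
  rw [count_aroots_of_mem_squarefreeFactor hT hi hz]
  rfl

/-! ### Truncation of series -/

theorem truncLT_sub (c : ℚ) (s t : Series) :
    HahnSeries.truncLT c (s - t) = HahnSeries.truncLT c s - HahnSeries.truncLT c t := by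
  ext e
  simp only [HahnSeries.coeff_truncLT, HahnSeries.coeff_sub]
  split_ifs <;> simp

theorem truncLT_conjSeries (c : ℚ) (s : Series) :
    HahnSeries.truncLT c (conjSeries s) = conjSeries (HahnSeries.truncLT c s) := by
  ext e
  simp only [HahnSeries.coeff_truncLT, conjSeries_coeff]
  split_ifs <;> simp

theorem leadingCoeff_truncLT {c : ℚ} {s : Series} (h : HahnSeries.truncLT c s ≠ 0) :
    (HahnSeries.truncLT c s).leadingCoeff = s.leadingCoeff := by
  have h1 : (HahnSeries.truncLT c s).coeff (HahnSeries.truncLT c s).order ≠ 0 :=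
    fun h0 => h (HahnSeries.coeff_order_eq_zero.1 h0)
  have h2 := h1
  rw [HahnSeries.coeff_truncLT] at h2
  split_ifs at h2 with hlt
  · have hle := HahnSeries.order_le_of_coeff_ne_zero h2
    have h3 : (HahnSeries.truncLT c s).coeff s.order = s.coeff s.order := by
      rw [HahnSeries.coeff_truncLT, if_pos (hle.trans_lt hlt)]
    have hs : s.coeff s.order ≠ 0 := fun h0 => h2 (by
      rw [HahnSeries.coeff_order_eq_zero.1 h0, HahnSeries.coeff_zero])
    have hge := HahnSeries.order_le_of_coeff_ne_zero (h3.trans_ne hs)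
    rw [leadingCoeff_eq_coeff_order, leadingCoeff_eq_coeff_order, le_antisymm hge hle, h3]
  · exact absurd rfl h2

theorem eventually_lt_natCast (e : ℚ) : ∀ᶠ N : ℕ in atTop, e < (N : ℚ) := by
  obtain ⟨n, hn⟩ := exists_nat_gt e
  filter_upwards [eventually_ge_atTop n] with N hN
  exact hn.trans_le (by exact_mod_cast hN)

theorem eventually_truncLT_ne_zero {s : Series} (h : s ≠ 0) :
    ∀ᶠ N : ℕ in atTop, HahnSeries.truncLT (N : ℚ) s ≠ 0 := by
  filter_upwards [eventually_lt_natCast s.order] with N hN h0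
  have := congrArg (fun t => t.coeff s.order) h0
  simp only [HahnSeries.coeff_truncLT, if_pos hN, HahnSeries.coeff_zero] at this
  exact h (HahnSeries.coeff_order_eq_zero.1 this)

theorem eventually_truncLT_ne {s t : Series} (h : s ≠ t) :
    ∀ᶠ N : ℕ in atTop, HahnSeries.truncLT (N : ℚ) s ≠ HahnSeries.truncLT (N : ℚ) t := by
  filter_upwards [eventually_truncLT_ne_zero (sub_ne_zero.2 h)] with N hN
  rwa [truncLT_sub, sub_ne_zero] at hN

theorem IsNonnegSeries.truncLT {s : Series} (h : IsNonnegSeries s) (c : ℚ) :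
    IsNonnegSeries (HahnSeries.truncLT c s) := by
  refine ⟨fun e => ?_, ?_⟩
  · rw [HahnSeries.coeff_truncLT]
    split_ifs
    · exact h.1 e
    · simp
  · by_cases h0 : HahnSeries.truncLT c s = 0
    · simp [h0]
    · rw [leadingCoeff_truncLT h0]
      exact h.2

theorem eventually_not_isNonnegSeries_truncLT {s : Series} (h : ¬ IsNonnegSeries s) :
    ∀ᶠ N : ℕ in atTop, ¬ IsNonnegSeries (HahnSeries.truncLT (N : ℚ) s) := by
  by_cases hr : IsRealSeries s
  · have hneg : ¬ 0 ≤ s.leadingCoeff.re := fun hn => h ⟨hr, hn⟩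
    have hs : s ≠ 0 := by
      rintro rfl
      simp at hneg
    filter_upwards [eventually_truncLT_ne_zero hs] with N hN hn
    exact hneg (leadingCoeff_truncLT hN ▸ hn.2)
  · obtain ⟨e, he⟩ := not_forall.1 hr
    filter_upwards [eventually_lt_natCast e] with N hN hn
    have := hn.1 e
    rw [HahnSeries.coeff_truncLT, if_pos hN] at this
    exact he this

theorem SeriesLT.of_truncLT {c : ℚ} {s t : Series}
    (h : SeriesLT (HahnSeries.truncLT c s) (HahnSeries.truncLT c t)) : SeriesLT s t := by
  unfold SeriesLT at h ⊢
  rw [← truncLT_sub] at h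
  have h0 : HahnSeries.truncLT c (t - s) ≠ 0 := by
    intro h0
    simp [h0] at h
  rwa [leadingCoeff_truncLT h0] at h

theorem SeriesLT.eventually_truncLT {s t : Series} (h : SeriesLT s t) :
    ∀ᶠ N : ℕ in atTop, SeriesLT (HahnSeries.truncLT (N : ℚ) s) (HahnSeries.truncLT (N : ℚ) t) := by
  unfold SeriesLT at h ⊢
  have h0 : t - s ≠ 0 := by
    intro h0
    simp [h0] at h
  filter_upwards [eventually_truncLT_ne_zero h0] with N hN
  rwa [← truncLT_sub, leadingCoeff_truncLT hN]

theorem SeriesLT.asymm {s t : Series} (h : SeriesLT s t) (h' : SeriesLT t s) : False := by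
  unfold SeriesLT at h h'
  rw [← neg_sub, HahnSeries.leadingCoeff_neg, Complex.neg_re] at h'
  linarith

/-! ### Termination and correctness of the search for the dominant root -/

/-- `z₀` is the greatest among the roots of `T` that are real and nonnegative as `Y` decreases to
`0`. -/
structure IsGreatestNonnegRoot (T : Polynomial K) (z₀ : L) : Prop where
  mem : z₀ ∈ T.aroots L
  nonneg : IsNonnegSeries (expand z₀)
  lt : ∀ z ∈ T.aroots L, z ≠ z₀ → IsNonnegSeries (expand z) → SeriesLT (expand z) (expand z₀)

theorem IsGreatestNonnegRoot.ne_zero {T : Polynomial K} {z₀ : L}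
    (h : IsGreatestNonnegRoot T z₀) : T ≠ 0 :=
  (Polynomial.mem_aroots.1 h.mem).1

/-- The truncation of a recognized entry belongs to only one root. -/
theorem eq_of_isDominantEntry {T : Polynomial K} {N : ℕ} {e : ℕ × Series} (hT : T ≠ 0)
    (he : IsDominantEntry (truncatedRoots T N) e) {z z' : L} (hz : z ∈ T.aroots L)
    (hz' : z' ∈ T.aroots L) (h : HahnSeries.truncLT (N : ℚ) (expand z) = e.2)
    (h' : HahnSeries.truncLT (N : ℚ) (expand z') = e.2) : z = z' := by
  classical
  have h1 := he.2.2.1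
  rw [truncatedRoots_eq hT, Multiset.map_map, Multiset.count_map, Multiset.card_eq_one] at h1
  obtain ⟨a, ha⟩ := h1
  have key : ∀ w ∈ T.aroots L, HahnSeries.truncLT (N : ℚ) (expand w) = e.2 → w = a := by
    intro w hw hwe
    rw [← Multiset.mem_singleton, ← ha]
    exact Multiset.mem_filter.2 ⟨Multiset.mem_dedup.2 hw, hwe.symm⟩
  rw [key z hz h, key z' hz' h']

/-- Any recognized entry is correct. Its root is real, since the conjugate root has the same
truncation; were it not the greatest nonnegative root `z₀`, its truncation would exceed that of
`z₀`, and so the root itself would be nonnegative and exceed `z₀`. -/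
theorem IsGreatestNonnegRoot.index_eq {T : Polynomial K} {z₀ : L} {N : ℕ} {e : ℕ × Series}
    [DecidableEq L] (h : IsGreatestNonnegRoot T z₀)
    (he : IsDominantEntry (truncatedRoots T N) e) : e.1 = (T.aroots L).count z₀ := by
  have hmem := he.1
  rw [truncatedRoots_eq h.ne_zero, Multiset.mem_map] at hmem
  obtain ⟨z, hz, hze⟩ := hmem
  rw [Multiset.mem_dedup] at hz
  have hz1 : e.1 = (T.aroots L).count z := (congrArg Prod.fst hze).symm
  have hz2 : HahnSeries.truncLT (N : ℚ) (expand z) = e.2 := congrArg Prod.snd hze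
  by_cases hzz : z = z₀
  · rw [hz1, hzz]
  exfalso
  have hreal : conjSeries (expand z) = expand z := by
    obtain ⟨z', hz', hconj⟩ := exists_conj_root hz
    rw [← hconj, eq_of_isDominantEntry h.ne_zero he hz' hz _ hz2]
    rw [hconj, truncLT_conjSeries, hz2]
    exact isRealSeries_iff.1 he.2.1.1
  set t₀ := HahnSeries.truncLT (N : ℚ) (expand z₀)
  have ht₀ : IsNonnegSeries t₀ := h.nonneg.truncLT N
  have hlt : SeriesLT t₀ e.2 := by
    refine he.2.2.2 ((T.aroots L).count z₀, t₀) ?_ ?_ ht₀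
    · rw [truncatedRoots_eq h.ne_zero, Multiset.mem_map]
      exact ⟨z₀, Multiset.mem_dedup.2 h.mem, rfl⟩
    · intro heq
      exact hzz (eq_of_isDominantEntry h.ne_zero he hz h.mem hz2 (congrArg Prod.snd heq))
  have hne : HahnSeries.truncLT (N : ℚ) (expand z) ≠ 0 := by
    intro h0
    rw [← hz2, h0, SeriesLT, zero_sub, HahnSeries.leadingCoeff_neg, Complex.neg_re] at hlt
    linarith [ht₀.2]
  have hnn : IsNonnegSeries (expand z) := by
    refine ⟨isRealSeries_iff.2 hreal, ?_⟩
    rw [← leadingCoeff_truncLT hne, hz2]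
    exact he.2.1.2
  exact (h.lt z hz hzz hnn).asymm (SeriesLT.of_truncLT (hz2 ▸ hlt))

/-- At a sufficiently high order the greatest nonnegative root is recognized. -/
theorem IsGreatestNonnegRoot.exists_isDominantEntry {T : Polynomial K} {z₀ : L}
    (h : IsGreatestNonnegRoot T z₀) : ∃ N e, IsDominantEntry (truncatedRoots T N) e := by
  classical
  have hev : ∀ᶠ N : ℕ in atTop, ∀ z ∈ (T.aroots L).toFinset, z ≠ z₀ →
      HahnSeries.truncLT (N : ℚ) (expand z) ≠ HahnSeries.truncLT (N : ℚ) (expand z₀) ∧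
      (IsNonnegSeries (HahnSeries.truncLT (N : ℚ) (expand z)) →
        SeriesLT (HahnSeries.truncLT (N : ℚ) (expand z))
          (HahnSeries.truncLT (N : ℚ) (expand z₀))) := by
    rw [Filter.eventually_all_finset]
    intro z hz
    by_cases hzz : z = z₀
    · exact Eventually.of_forall fun _ hne => absurd hzz hne
    rw [Multiset.mem_toFinset] at hz
    have h1 := eventually_truncLT_ne (expand_injective.ne hzz)
    by_cases hnn : IsNonnegSeries (expand z)
    · filter_upwards [h1, (h.lt z hz hzz hnn).eventually_truncLT] with N hN1 hN2 _
      exact ⟨hN1, fun _ => hN2⟩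
    · filter_upwards [h1, eventually_not_isNonnegSeries_truncLT hnn] with N hN1 hN2 _
      exact ⟨hN1, fun h3 => absurd h3 hN2⟩
  obtain ⟨N, hN⟩ := hev.exists
  have hE := truncatedRoots_eq h.ne_zero N
  refine ⟨N, ((T.aroots L).count z₀, HahnSeries.truncLT (N : ℚ) (expand z₀)), ?_, ?_, ?_, ?_⟩
  · rw [hE]
    exact Multiset.mem_map.2 ⟨z₀, Multiset.mem_dedup.2 h.mem, rfl⟩
  · exact h.nonneg.truncLT N
  · rw [hE, Multiset.map_map, Multiset.count_map, Multiset.card_eq_one]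
    refine ⟨z₀, ?_⟩
    refine (Multiset.Nodup.ext ((Multiset.nodup_dedup _).filter _)
      (Multiset.nodup_singleton z₀)).2 fun z => ?_
    rw [Multiset.mem_filter, Multiset.mem_dedup, Multiset.mem_singleton]
    constructor
    · rintro ⟨hz, hze⟩
      by_contra hzz
      exact (hN z (Multiset.mem_toFinset.2 hz) hzz).1 hze.symm
    · rintro rfl
      exact ⟨h.mem, rfl⟩
  · intro e' he' hne hnn
    rw [hE, Multiset.mem_map] at he'
    obtain ⟨z, hz, rfl⟩ := he'
    have hzz : z ≠ z₀ := by
      rintro rfl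
      exact hne rfl
    exact (hN z (Multiset.mem_toFinset.2 (Multiset.mem_dedup.1 hz)) hzz).2 hnn

/-- The procedure terminates and returns the multiplicity in `R ⊗ R` of its greatest nonnegative
root. -/
theorem dominantIndex_eq [DecidableEq L] {R : Polynomial K} {z₀ : L}
    (h : IsGreatestNonnegRoot (tensorSquare R) z₀) :
    dominantIndex R = Part.some (((tensorSquare R).aroots L).count z₀) := by
  classical
  rw [Part.eq_some_iff, dominantIndex, Part.mem_bind_iff]
  obtain ⟨N, hN⟩ := h.exists_isDominantEntry
  obtain ⟨n, hn, -⟩ := Nat.rfind_min' (p := fun N => decide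
    (∃ e, IsDominantEntry (truncatedRoots (tensorSquare R) N) e)) (decide_eq_true hN)
  refine ⟨n, by convert hn; rfl, ?_⟩
  have hex : ∃ e, IsDominantEntry (truncatedRoots (tensorSquare R) n) e := by
    simpa using Nat.rfind_spec hn
  rw [Part.assert_pos hex, Part.mem_some_iff]
  exact (h.index_eq hex.choose_spec).symm

/-! ### Products of roots of large modulus -/

section Dominant

variable (S : Finset ℂ) (ρ : ℝ)

/-- The elements of `S` of modulus greater than `ρ`. -/
def outer : Finset ℂ := S.filter fun z => ρ < ‖z‖

/-- The elements of `S` of modulus `ρ`. -/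
def onCircle : Finset ℂ := S.filter fun z => ‖z‖ = ρ

variable {S ρ}

theorem mem_outer {z : ℂ} : z ∈ outer S ρ ↔ z ∈ S ∧ ρ < ‖z‖ := Finset.mem_filter

theorem mem_onCircle {z : ℂ} : z ∈ onCircle S ρ ↔ z ∈ S ∧ ‖z‖ = ρ := Finset.mem_filter

theorem notMem_outer_of_mem_onCircle {c : ℂ} (hc : c ∈ onCircle S ρ) : c ∉ outer S ρ :=
  fun h => (mem_outer.1 h).2.ne' (mem_onCircle.1 hc).2

theorem prod_outer_ne_zero (hρ : 0 ≤ ρ) : ∏ z ∈ outer S ρ, z ≠ 0 :=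
  Finset.prod_ne_zero_iff.2 fun _ hz => norm_pos_iff.1 (hρ.trans_lt (mem_outer.1 hz).2)

theorem card_sdiff_outer {s : Finset ℂ} (hs : s.card = (outer S ρ).card + 1) :
    (s \ outer S ρ).card = (outer S ρ \ s).card + 1 := by
  have h1 := Finset.card_sdiff_add_card_inter s (outer S ρ)
  have h2 := Finset.card_sdiff_add_card_inter (outer S ρ) s
  rw [Finset.inter_comm] at h2
  omega

theorem prod_norm_sdiff_le {s : Finset ℂ} (hsS : s ⊆ S)
    (hs : s.card = (outer S ρ).card + 1) :
    ∏ z ∈ s \ outer S ρ, ‖z‖ ≤ ρ ^ (outer S ρ \ s).card * ρ := by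
  have hle : ∏ z ∈ s \ outer S ρ, ‖z‖ ≤ ∏ _z ∈ s \ outer S ρ, ρ := by
    refine Finset.prod_le_prod (fun _ _ => norm_nonneg _) fun z hz => ?_
    rw [Finset.mem_sdiff, mem_outer, not_and, not_lt] at hz
    exact hz.2 (hsS hz.1)
  rwa [Finset.prod_const, card_sdiff_outer hs, pow_succ] at hle

/-- Among the products of `#(outer S ρ) + 1` elements of `S`, none has modulus greater than that of
the product of all elements of modulus `> ρ` and one of modulus `ρ`. -/
theorem norm_prod_le (hρ : 0 ≤ ρ) {s : Finset ℂ} (hsS : s ⊆ S)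
    (hs : s.card = (outer S ρ).card + 1) : ‖∏ z ∈ s, z‖ ≤ ‖∏ z ∈ outer S ρ, z‖ * ρ := by
  have h1 : ρ ^ (outer S ρ \ s).card ≤ ∏ z ∈ outer S ρ \ s, ‖z‖ := by
    rw [← Finset.prod_const]
    exact Finset.prod_le_prod (fun _ _ => hρ) fun z hz =>
      (mem_outer.1 (Finset.mem_sdiff.1 hz).1).2.le
  rw [norm_prod, norm_prod, ← Finset.prod_inter_mul_prod_sdiff s (outer S ρ),
    ← Finset.prod_inter_mul_prod_sdiff (outer S ρ) s, Finset.inter_comm (outer S ρ) s, mul_assoc]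
  refine mul_le_mul_of_nonneg_left ?_ (Finset.prod_nonneg fun _ _ => norm_nonneg _)
  exact (prod_norm_sdiff_le hsS hs).trans (mul_le_mul_of_nonneg_right h1 hρ)

/-- The products of greatest modulus are those of all elements of modulus `> ρ` and one element of
modulus `ρ`. -/
theorem exists_eq_insert_of_norm_prod_eq (hρ : 0 ≤ ρ) {s : Finset ℂ} (hsS : s ⊆ S)
    (hs : s.card = (outer S ρ).card + 1) (heq : ‖∏ z ∈ s, z‖ = ‖∏ z ∈ outer S ρ, z‖ * ρ) :
    ∃ c ∈ onCircle S ρ, s = insert c (outer S ρ) := by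
  have hne := prod_outer_ne_zero (S := S) hρ
  have hsub : outer S ρ ⊆ s := by
    rcases hρ.eq_or_lt with h0 | hpos
    · -- for `ρ = 0` all elements except `0` are outer, and `s` exhausts `S`
      have h1 : s ⊆ insert 0 (outer S ρ) := by
        intro z hz
        rw [Finset.mem_insert, mem_outer, ← h0, norm_pos_iff]
        by_cases hz0 : z = 0
        · exact Or.inl hz0
        · exact Or.inr ⟨hsS hz, hz0⟩
      rw [Finset.eq_of_subset_of_card_le h1 ((Finset.card_insert_le _ _).trans hs.ge)]
      exact Finset.subset_insert _ _
    · rw [← Finset.sdiff_eq_empty_iff_subset]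
      by_contra hD
      have hlt : ρ ^ (outer S ρ \ s).card < ∏ z ∈ outer S ρ \ s, ‖z‖ := by
        rw [← Finset.prod_const]
        exact Finset.prod_lt_prod_of_nonempty (fun _ _ => hpos)
          (fun z hz => (mem_outer.1 (Finset.mem_sdiff.1 hz).1).2)
          (Finset.nonempty_iff_ne_empty.2 hD)
      rw [norm_prod, norm_prod, ← Finset.prod_inter_mul_prod_sdiff s (outer S ρ),
        ← Finset.prod_inter_mul_prod_sdiff (outer S ρ) s, Finset.inter_comm (outer S ρ) s,
        mul_assoc] at heq
      have hpos' : 0 < ∏ z ∈ s ∩ outer S ρ, ‖z‖ := Finset.prod_pos fun z hz =>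
        hpos.trans (mem_outer.1 (Finset.mem_inter.1 hz).2).2
      have h2 := mul_left_cancel₀ hpos'.ne' heq
      have h3 := prod_norm_sdiff_le hsS hs
      have h4 := mul_lt_mul_of_pos_right hlt hpos
      linarith
  have hcard := card_sdiff_outer hs
  rw [Finset.sdiff_eq_empty_iff_subset.2 hsub, Finset.card_empty, zero_add,
    Finset.card_eq_one] at hcard
  obtain ⟨c, hc⟩ := hcard
  have hcs : c ∈ s \ outer S ρ := hc ▸ Finset.mem_singleton_self c
  have hins : s = insert c (outer S ρ) := by
    rw [← Finset.sdiff_union_of_subset hsub, hc]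
    exact (Finset.insert_eq _ _).symm
  refine ⟨c, mem_onCircle.2 ⟨hsS (Finset.mem_sdiff.1 hcs).1, ?_⟩, hins⟩
  rw [hins, Finset.prod_insert (Finset.mem_sdiff.1 hcs).2, norm_mul, mul_comm] at heq
  exact mul_left_cancel₀ (norm_ne_zero_iff.2 hne) heq

theorem conj_prod_outer (hconj : ∀ z ∈ S, starRingEnd ℂ z ∈ S) :
    starRingEnd ℂ (∏ z ∈ outer S ρ, z) = ∏ z ∈ outer S ρ, z := by
  rw [map_prod]
  refine Finset.prod_nbij' (starRingEnd ℂ) (starRingEnd ℂ) ?_ ?_ ?_ ?_ ?_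
  · intro z hz
    rw [mem_outer] at hz ⊢
    exact ⟨hconj z hz.1, by rw [Complex.norm_conj]; exact hz.2⟩
  · intro z hz
    rw [mem_outer] at hz ⊢
    exact ⟨hconj z hz.1, by rw [Complex.norm_conj]; exact hz.2⟩
  all_goals simp

theorem prod_insert_mul_prod_insert (hconj : ∀ z ∈ S, starRingEnd ℂ z ∈ S) (hρ : 0 ≤ ρ)
    {c c' : ℂ} (hc : c ∈ onCircle S ρ)
    (hc' : c' ∈ onCircle S ρ) :
    (∏ z ∈ insert c (outer S ρ), z) * (∏ z ∈ insert c' (outer S ρ), z) =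
      (((‖∏ z ∈ outer S ρ, z‖ * ρ) ^ 2 : ℝ) : ℂ) ↔ c' = starRingEnd ℂ c := by
  rw [Finset.prod_insert (notMem_outer_of_mem_onCircle hc),
    Finset.prod_insert (notMem_outer_of_mem_onCircle hc')]
  set P := ∏ z ∈ outer S ρ, z with hP
  have hP0 : P ≠ 0 := prod_outer_ne_zero hρ
  have hPP : P * P = ((‖P‖ ^ 2 : ℝ) : ℂ) := by
    have h1 : starRingEnd ℂ P = P := conj_prod_outer hconj
    have := Complex.mul_conj' P
    rw [h1] at this
    rw [this]
    push_cast
    rfl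
  have hcc : c * starRingEnd ℂ c = ((ρ ^ 2 : ℝ) : ℂ) := by
    rw [Complex.mul_conj', (mem_onCircle.1 hc).2]
    push_cast
    rfl
  have h2 : c * P * (c' * P) = P * P * (c * c') := by ring
  have h3 : (((‖P‖ * ρ) ^ 2 : ℝ) : ℂ) = P * P * (c * starRingEnd ℂ c) := by
    rw [hPP, hcc]
    push_cast
    ring
  rw [h2, h3, mul_right_inj' (mul_ne_zero hP0 hP0)]
  constructor
  · intro h
    by_cases hc0 : c = 0
    · have hρ0 : ρ = 0 := by rw [← (mem_onCircle.1 hc).2, hc0, norm_zero]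
      have hc0' : c' = 0 := by rw [← norm_eq_zero, (mem_onCircle.1 hc').2, hρ0]
      rw [hc0, hc0', map_zero]
    · exact mul_left_cancel₀ hc0 h
  · rintro rfl
    rfl

/-- The pairs of `m`-fold products, `m = #(outer S ρ) + 1`, whose product is the greatest possible
modulus correspond to pairs of conjugate elements of modulus `ρ`. -/
theorem card_pairs_eq_card_onCircle (hconj : ∀ z ∈ S, starRingEnd ℂ z ∈ S)
    (hρ : 0 ≤ ρ) :
    (((S.powersetCard ((outer S ρ).card + 1)) ×ˢ (S.powersetCard ((outer S ρ).card + 1))).filter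
      fun x => (∏ z ∈ x.1, z) * (∏ z ∈ x.2, z) =
        (((‖∏ z ∈ outer S ρ, z‖ * ρ) ^ 2 : ℝ) : ℂ)).card = (onCircle S ρ).card := by
  symm
  have hconjC : ∀ c ∈ onCircle S ρ, starRingEnd ℂ c ∈ onCircle S ρ := fun c hc => by
    rw [mem_onCircle] at hc ⊢
    exact ⟨hconj c hc.1, by rw [Complex.norm_conj]; exact hc.2⟩
  have hmem : ∀ c ∈ onCircle S ρ,
      insert c (outer S ρ) ∈ S.powersetCard ((outer S ρ).card + 1) := fun c hc => by
    rw [Finset.mem_powersetCard, Finset.card_insert_of_notMem (notMem_outer_of_mem_onCircle hc)]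
    refine ⟨Finset.insert_subset (mem_onCircle.1 hc).1 ?_, rfl⟩
    exact Finset.filter_subset _ _
  refine Finset.card_bij
    (fun c _ => (insert c (outer S ρ), insert (starRingEnd ℂ c) (outer S ρ))) ?_ ?_ ?_
  · intro c hc
    rw [Finset.mem_filter, Finset.mem_product]
    exact ⟨⟨hmem c hc, hmem _ (hconjC c hc)⟩,
      (prod_insert_mul_prod_insert hconj hρ hc (hconjC c hc)).2 rfl⟩
  · intro c hc c' hc' h
    have h1 : c ∈ insert c' (outer S ρ) := by
      have h2 : insert c (outer S ρ) = insert c' (outer S ρ) := congrArg Prod.fst h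
      rw [← h2]
      exact Finset.mem_insert_self _ _
    exact (Finset.mem_insert.1 h1).resolve_right (notMem_outer_of_mem_onCircle hc)
  · rintro ⟨s, s'⟩ hs
    rw [Finset.mem_filter, Finset.mem_product, Finset.mem_powersetCard,
      Finset.mem_powersetCard] at hs
    obtain ⟨⟨⟨hsS, hsc⟩, ⟨hsS', hsc'⟩⟩, hprod⟩ := hs
    have h1 := norm_prod_le hρ hsS hsc
    have h2 := norm_prod_le hρ hsS' hsc'
    have h3 := congrArg norm hprod
    rw [norm_mul, Complex.norm_real, Real.norm_of_nonneg (sq_nonneg _)] at h3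
    dsimp only at h3 hprod
    have h4 : ‖∏ z ∈ s, z‖ = ‖∏ z ∈ outer S ρ, z‖ * ρ ∧
        ‖∏ z ∈ s', z‖ = ‖∏ z ∈ outer S ρ, z‖ * ρ := by
      set a := ‖∏ z ∈ s, z‖
      set b := ‖∏ z ∈ s', z‖
      set M := ‖∏ z ∈ outer S ρ, z‖ * ρ
      have ha : 0 ≤ a := norm_nonneg _
      have hb : 0 ≤ b := norm_nonneg _
      rcases (ha.trans h1).eq_or_lt with hM | hM
      · constructor <;> linarith
      · constructor <;> nlinarith
    obtain ⟨c, hc, rfl⟩ := exists_eq_insert_of_norm_prod_eq hρ hsS hsc h4.1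
    obtain ⟨c', hc', rfl⟩ := exists_eq_insert_of_norm_prod_eq hρ hsS' hsc' h4.2
    rw [prod_insert_mul_prod_insert hconj hρ hc hc'] at hprod
    exact ⟨c, hc, by rw [hprod]⟩

end Dominant

/-- The multiset of products of two `m`-fold products of members of `A`. -/
def productPairs (A : Multiset ℂ) (m : ℕ) : Multiset ℂ :=
  (((Multiset.powersetCard m A).map Multiset.prod) ×ˢ
    ((Multiset.powersetCard m A).map Multiset.prod)).map fun p => p.1 * p.2

theorem productPairs_eq (S : Finset ℂ) (m : ℕ) :
    productPairs S.val m = (S.powersetCard m ×ˢ S.powersetCard m).val.map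
      fun x => (∏ z ∈ x.1, z) * (∏ z ∈ x.2, z) := by
  have h1 : (Multiset.powersetCard m S.val).map Multiset.prod =
      (S.powersetCard m).val.map fun s => ∏ z ∈ s, z := by
    rw [← Finset.map_val_val_powersetCard, Multiset.map_map]
    refine Multiset.map_congr rfl fun s _ => ?_
    exact Finset.prod_val s
  rw [productPairs, h1, Finset.product_val]
  simp only [SProd.sprod, Multiset.product, Multiset.map_bind, Multiset.bind_map,
    Multiset.map_map, Function.comp]

open Classical in
theorem count_productPairs {S : Finset ℂ} (hconj : ∀ z ∈ S, starRingEnd ℂ z ∈ S) {ρ : ℝ}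
    (hρ : 0 ≤ ρ) :
    (productPairs S.val ((outer S ρ).card + 1)).count
      (((‖∏ z ∈ outer S ρ, z‖ * ρ) ^ 2 : ℝ) : ℂ) = (onCircle S ρ).card := by
  rw [← card_pairs_eq_card_onCircle hconj hρ, productPairs_eq, Multiset.count_map]
  simp only [Finset.card_def, Finset.filter_val, eq_comm]

theorem norm_le_of_mem_productPairs {S : Finset ℂ} {ρ : ℝ} (hρ : 0 ≤ ρ) {w : ℂ}
    (hw : w ∈ productPairs S.val ((outer S ρ).card + 1)) :
    ‖w‖ ≤ (‖∏ z ∈ outer S ρ, z‖ * ρ) ^ 2 := by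
  rw [productPairs_eq, Multiset.mem_map] at hw
  obtain ⟨⟨s, s'⟩, hs, rfl⟩ := hw
  rw [Finset.mem_val, Finset.mem_product, Finset.mem_powersetCard, Finset.mem_powersetCard] at hs
  rw [norm_mul, sq]
  exact mul_le_mul (norm_prod_le hρ hs.1.1 hs.1.2) (norm_prod_le hρ hs.2.1 hs.2.2)
    (norm_nonneg _) (by positivity)

/-! ### The main loop -/

/-- If each round produces the next member of `q` from the preceding ones, the loop returns `q`. -/
theorem round_fix_eq {f : Polynomial K} {q : List ℕ} (hsum : q.sum = f.natDegree)
    (hpos : ∀ x ∈ q, 0 < x)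
    (hstep : ∀ k (hk : k < q.length),
      dominantIndex (subsetProducts f ((q.take k).sum + 1)) = Part.some q[k]) :
    PFun.fix (round f) [] = Part.some q := by
  suffices h : ∀ j k, k + j = q.length → PFun.fix (round f) (q.take k) = Part.some q by
    simpa using h q.length 0 (zero_add _)
  intro j
  induction j with
  | zero =>
    intro k hk
    rw [List.take_of_length_le (by omega), Part.eq_some_iff]
    refine PFun.fix_stop ?_
    rw [round, if_neg (by omega)]
    exact Part.mem_some _
  | succ j ih =>
    intro k hk
    have hk' : k < q.length := by omega
    have hlt : (q.take k).sum < f.natDegree := by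
      have h1 := List.sum_take_add_sum_drop q k
      rw [List.drop_eq_getElem_cons hk', List.sum_cons] at h1
      have := hpos _ (List.getElem_mem hk')
      omega
    rw [← ih (k + 1) (by omega)]
    refine PFun.fix_fwd_eq ?_
    rw [round, if_pos hlt, hstep k hk', Part.map_some, Part.mem_some_iff,
      List.take_append_getElem]

/-! ### Counting roots by modulus -/

theorem moduli_eq {p : Polynomial ℂ} {S : Finset ℂ} (hS : p.roots = S.val) :
    moduli p = (S.image fun z => ‖z‖).sort (fun a b => a ≥ b) := by
  classical
  have : p.roots.toFinset = S := by rw [hS, Finset.val_toFinset]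
  rw [moduli, ← this]

theorem mem_moduli {p : Polynomial ℂ} {S : Finset ℂ} (hS : p.roots = S.val) {r : ℝ} :
    r ∈ moduli p ↔ ∃ z ∈ S, ‖z‖ = r := by
  rw [moduli_eq hS, Finset.mem_sort, Finset.mem_image]

theorem moduli_sortedGT {p : Polynomial ℂ} {S : Finset ℂ} (hS : p.roots = S.val) :
    (moduli p).SortedGT := by
  rw [moduli_eq hS]
  exact Finset.sortedGT_sort _

theorem moduliCounts_eq {p : Polynomial ℂ} {S : Finset ℂ} (hS : p.roots = S.val) :
    moduliCounts p = (moduli p).map fun r => (onCircle S r).card := by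
  refine List.map_congr_left fun r _ => ?_
  rw [hS, Multiset.countP_eq_card_filter, onCircle, Finset.card_def, Finset.filter_val]

theorem sum_map_card_onCircle (S : Finset ℂ) {l : List ℝ} (hl : l.Nodup) :
    (l.map fun r => (onCircle S r).card).sum = (S.filter fun z => ‖z‖ ∈ l).card := by
  rw [← List.sum_toFinset _ hl, Finset.card_eq_sum_card_fiberwise (t := l.toFinset)
    (f := fun z => ‖z‖)]
  · refine Finset.sum_congr rfl fun r hr => ?_
    congr 1
    ext z
    rw [mem_onCircle, Finset.mem_filter, Finset.mem_filter]
    constructor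
    · rintro ⟨h1, rfl⟩
      exact ⟨⟨h1, List.mem_toFinset.1 hr⟩, rfl⟩
    · rintro ⟨⟨h1, -⟩, h2⟩
      exact ⟨h1, h2⟩
  · intro z hz
    simpa using (Finset.mem_filter.1 hz).2

theorem sum_moduliCounts {p : Polynomial ℂ} {S : Finset ℂ} (hS : p.roots = S.val) :
    (moduliCounts p).sum = S.card := by
  rw [moduliCounts_eq hS, sum_map_card_onCircle S (moduli_sortedGT hS).nodup]
  congr 1
  exact Finset.filter_true_of_mem fun z hz => (mem_moduli hS).2 ⟨z, hz, rfl⟩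

theorem moduliCounts_pos {p : Polynomial ℂ} {S : Finset ℂ} (hS : p.roots = S.val) :
    ∀ x ∈ moduliCounts p, 0 < x := by
  intro x hx
  rw [moduliCounts_eq hS, List.mem_map] at hx
  obtain ⟨r, hr, rfl⟩ := hx
  obtain ⟨z, hz, hzr⟩ := (mem_moduli hS).1 hr
  exact Finset.card_pos.2 ⟨z, mem_onCircle.2 ⟨hz, hzr⟩⟩

theorem sum_take_moduliCounts {p : Polynomial ℂ} {S : Finset ℂ} (hS : p.roots = S.val) {k : ℕ}
    (hk : k < (moduli p).length) :
    ((moduliCounts p).take k).sum = (outer S (moduli p)[k]).card := by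
  have hsort := moduli_sortedGT hS
  rw [moduliCounts_eq hS, ← List.map_take,
    sum_map_card_onCircle S (hsort.nodup.sublist (List.take_sublist _ _))]
  congr 1
  ext z
  rw [Finset.mem_filter, mem_outer]
  refine and_congr_right fun hz => ?_
  rw [List.mem_take_iff_getElem]
  constructor
  · rintro ⟨i, hi, hiz⟩
    rw [← hiz]
    exact hsort.getElem_lt_getElem_iff.2 (by omega)
  · intro hlt
    obtain ⟨i, hi, hiz⟩ := List.mem_iff_getElem.1 ((mem_moduli hS).2 ⟨z, hz, rfl⟩)
    rw [← hiz] at hlt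
    have := hsort.getElem_lt_getElem_iff.1 hlt
    exact ⟨i, by omega, hiz⟩

/-! ### Square-free polynomials over `ℚ(Y)` -/

/-- Gauss's lemma: a square-free polynomial in `ℚ[Y][X]` has no repeated factor over `ℚ(Y)`. -/
theorem squarefree_overField {Q : Polynomial (Polynomial ℚ)} (hQ : Squarefree Q) :
    Squarefree (overField Q) := by
  have := Classical.arbitrary (NormalizedGCDMonoid (Polynomial ℚ))
  intro g hg
  have hg0 : g ≠ 0 := by
    rintro rfl
    rw [zero_mul, zero_dvd_iff, overField, Polynomial.map_eq_zero_iff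
      (IsFractionRing.injective (Polynomial ℚ) K)] at hg
    exact hQ.ne_zero hg
  set G := IsLocalization.integerNormalization (nonZeroDivisors (Polynomial ℚ)) g with hG
  obtain ⟨b, hb, hbg⟩ := IsLocalization.integerNormalization_spec
    (nonZeroDivisors (Polynomial ℚ)) g
  have hbK : IsUnit (Polynomial.C (algebraMap (Polynomial ℚ) K b)) :=
    Polynomial.isUnit_C.2 (IsUnit.mk0 _ (IsFractionRing.to_map_ne_zero_of_mem_nonZeroDivisors hb))
  have hdvd : G.primPart.map (algebraMap (Polynomial ℚ) K) ∣ g := by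
    refine (hbK.dvd_mul_left).1 ?_
    rw [← Polynomial.smul_eq_C_mul, algebraMap_smul, ← hbg, ← hG]
    exact Polynomial.map_dvd _ ⟨_, by rw [mul_comm]; exact G.eq_C_content_mul_primPart⟩
  have hprim : (G.primPart * G.primPart).IsPrimitive :=
    G.isPrimitive_primPart.mul G.isPrimitive_primPart
  have h1 : G.primPart * G.primPart ∣ Q := by
    refine hprim.dvd_of_fraction_map_dvd_fraction_map (K := K) ?_
    rw [Polynomial.map_mul]
    exact (mul_dvd_mul hdvd hdvd).trans hg
  exact Polynomial.isUnit_or_eq_zero_of_isUnit_integerNormalization_primPart hg0 (hQ _ h1)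

/-! ### Algebraic functions at small positive arguments -/

/-- The value at the real number `y` of (the Puiseux expansion of) an algebraic function. -/
def evalAt (y : ℝ) (z : L) : ℂ := value (expand z) y

theorem eventually_forall_mem {α : Type*} {P : α → ℝ → Prop} (M : Multiset α)
    (h : ∀ z ∈ M, ∀ᶠ y : ℝ in 𝓝[>] 0, P z y) : ∀ᶠ y : ℝ in 𝓝[>] 0, ∀ z ∈ M, P z y :=
  (Filter.eventually_all_finite (Multiset.finite_toSet M)).2 h

theorem eventually_hasValue_expand (z : L) :
    ∀ᶠ y : ℝ in 𝓝[>] 0, HasValue (expand z) y (evalAt y z) :=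
  (isConvPuiseux_expand z).eventually_hasValue

theorem eventually_evalAt_mul (a b : L) :
    ∀ᶠ y : ℝ in 𝓝[>] 0, evalAt y (a * b) = evalAt y a * evalAt y b := by
  filter_upwards [eventually_hasValue_expand a, eventually_hasValue_expand b, eventually_pos]
    with y ha hb hy
  rw [evalAt, map_mul]
  exact (ha.mul hy hb).value_eq

theorem eventually_evalAt_prod (s : Multiset L) :
    ∀ᶠ y : ℝ in 𝓝[>] 0, evalAt y s.prod = (s.map (evalAt y)).prod := by
  induction s using Multiset.induction_on with
  | empty =>
    refine Eventually.of_forall fun y => ?_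
    rw [Multiset.prod_zero, Multiset.map_zero, Multiset.prod_zero, evalAt, map_one]
    exact (hasValue_one y).value_eq
  | cons a s ih =>
    filter_upwards [ih, eventually_evalAt_mul a s.prod] with y h1 h2
    rw [Multiset.prod_cons, h2, h1, Multiset.map_cons, Multiset.prod_cons]

theorem eventually_evalAt_ne {a b : L} (h : a ≠ b) :
    ∀ᶠ y : ℝ in 𝓝[>] 0, evalAt y a ≠ evalAt y b := by
  by_contra hcon
  refine h (expand_injective ?_)
  refine (isConvPuiseux_expand a).eq_of_eventually_value_eq (isConvPuiseux_expand b) ?_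
  exact fun hne => hcon hne

theorem isNonnegSeries_iff_eventually {s : Series} (hs : IsConvPuiseux s) :
    ∀ᶠ y : ℝ in 𝓝[>] 0, IsNonnegSeries s ↔ (value s y).im = 0 ∧ 0 ≤ (value s y).re := by
  by_cases hr : IsRealSeries s
  · have him : ∀ᶠ y : ℝ in 𝓝[>] 0, (value s y).im = 0 := by
      filter_upwards [hs.eventually_hasValue] with y hy
      have h1 := hy.conj
      rw [isRealSeries_iff.1 hr] at h1
      exact Complex.conj_eq_iff_im.1 (HasSum.unique h1 hy)
    have hlc : s.leadingCoeff.im = 0 := by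
      rw [leadingCoeff_eq_coeff_order]
      exact hr _
    rcases lt_trichotomy s.leadingCoeff.re 0 with h | h | h
    · have h2 := hs.neg.eventually_value_re_pos (by
        rw [HahnSeries.leadingCoeff_neg, Complex.neg_re]; linarith)
      filter_upwards [h2, hs.eventually_hasValue] with y hy hv
      rw [hv.neg.value_eq, Complex.neg_re] at hy
      constructor
      · intro hn
        exact absurd hn.2 (not_le.2 h)
      · rintro ⟨-, h4⟩
        linarith
    · have h0 : s = 0 := HahnSeries.leadingCoeff_eq_zero.1 (Complex.ext h hlc)
      subst h0
      refine Eventually.of_forall fun y => ?_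
      simp [value_zero, IsNonnegSeries, hr]
    · filter_upwards [hs.eventually_value_re_pos h, him] with y hy hi
      exact ⟨fun _ => ⟨hi, hy.le⟩, fun _ => ⟨hr, h.le⟩⟩
  · have hne : conjSeries s ≠ s := fun h => hr (isRealSeries_iff.2 h)
    have h1 : ∀ᶠ y : ℝ in 𝓝[>] 0, value (conjSeries s) y ≠ value s y := by
      by_contra hcon
      exact hne (hs.conj.eq_of_eventually_value_eq hs fun h => hcon h)
    filter_upwards [h1, hs.eventually_hasValue] with y hy hv
    constructor
    · intro h
      exact absurd h.1 hr
    · rintro ⟨h, -⟩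
      rw [hv.conj.value_eq] at hy
      exact absurd (Complex.conj_eq_iff_im.2 h) hy

theorem eventually_seriesLT_of_value_lt {s t : Series} (hs : IsConvPuiseux s)
    (ht : IsConvPuiseux t) (hsr : IsRealSeries s) (htr : IsRealSeries t) :
    ∀ᶠ y : ℝ in 𝓝[>] 0, (value s y).re < (value t y).re → SeriesLT s t := by
  have hr : IsRealSeries (t - s) := by
    rw [isRealSeries_iff, map_sub, isRealSeries_iff.1 hsr, isRealSeries_iff.1 htr]
  have hc : IsConvPuiseux (s - t) := by
    rw [sub_eq_add_neg]
    exact hs.add ht.neg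
  by_cases hlt : SeriesLT s t
  · exact Eventually.of_forall fun _ _ => hlt
  have hle : (t - s).leadingCoeff.re ≤ 0 := not_lt.1 hlt
  rcases hle.eq_or_lt with h | h
  · have h0 : t - s = 0 := by
      refine HahnSeries.leadingCoeff_eq_zero.1 (Complex.ext h ?_)
      rw [leadingCoeff_eq_coeff_order]
      exact hr _
    rw [sub_eq_zero.1 h0]
    exact Eventually.of_forall fun _ h => absurd h (lt_irrefl _)
  · have h1 := hc.eventually_value_re_pos (by
      rw [← neg_sub, HahnSeries.leadingCoeff_neg, Complex.neg_re]; linarith)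
    filter_upwards [h1, hs.eventually_hasValue, ht.eventually_hasValue] with y hy h2 h3 h4
    rw [(h2.sub h3).value_eq, Complex.sub_re] at hy
    linarith

/-- The values at `y` of the members of `M` determine the members, their signs and their order. -/
structure Separates (y : ℝ) (M : Multiset L) : Prop where
  inj : ∀ z ∈ M, ∀ z' ∈ M, evalAt y z = evalAt y z' → z = z'
  nonneg_iff : ∀ z ∈ M, IsNonnegSeries (expand z) ↔ (evalAt y z).im = 0 ∧ 0 ≤ (evalAt y z).re
  lt : ∀ z ∈ M, ∀ z' ∈ M, IsNonnegSeries (expand z) → IsNonnegSeries (expand z') →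
    (evalAt y z).re < (evalAt y z').re → SeriesLT (expand z) (expand z')

theorem eventually_separates (M : Multiset L) : ∀ᶠ y : ℝ in 𝓝[>] 0, Separates y M := by
  have h1 : ∀ᶠ y : ℝ in 𝓝[>] 0, ∀ z ∈ M, ∀ z' ∈ M, evalAt y z = evalAt y z' → z = z' := by
    refine eventually_forall_mem M fun z _ => eventually_forall_mem M fun z' _ => ?_
    by_cases h : z = z'
    · exact Eventually.of_forall fun _ _ => h
    · exact (eventually_evalAt_ne h).mono fun y hy h' => absurd h' hy
  have h2 := eventually_forall_mem M fun z _ =>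
    isNonnegSeries_iff_eventually (isConvPuiseux_expand z)
  have h3 : ∀ᶠ y : ℝ in 𝓝[>] 0, ∀ z ∈ M, ∀ z' ∈ M, IsNonnegSeries (expand z) →
      IsNonnegSeries (expand z') → (evalAt y z).re < (evalAt y z').re →
      SeriesLT (expand z) (expand z') := by
    refine eventually_forall_mem M fun z _ => eventually_forall_mem M fun z' _ => ?_
    by_cases h : IsNonnegSeries (expand z) ∧ IsNonnegSeries (expand z')
    · filter_upwards [eventually_seriesLT_of_value_lt (isConvPuiseux_expand z)
        (isConvPuiseux_expand z') h.1.1 h.2.1] with y hy _ _ using hy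
    · exact Eventually.of_forall fun y ha hb => absurd ⟨ha, hb⟩ h
  filter_upwards [h1, h2, h3] with y h1 h2 h3 using ⟨h1, h2, h3⟩

/-! ### Specialization of the roots -/

theorem specialize_eq_valuePoly (Q : Polynomial (Polynomial ℚ)) (y : ℝ) :
    specialize Q y = valuePoly ((overField Q).map toConvPuiseux) y := by
  ext i
  rw [valuePoly_coeff, specialize, Polynomial.coeff_map, Polynomial.coeff_map, overField,
    Polynomial.coeff_map]
  change _ = value (toSeries (algebraMap (Polynomial ℚ) K (Q.coeff i))) y
  rw [toSeries_algebraMap, (hasValue_polyToSeries _ y).value_eq]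
  rfl

theorem eventually_valuePoly_X_sub_C (a : ConvPuiseux) :
    ∀ᶠ y : ℝ in 𝓝[>] 0, valuePoly (Polynomial.X - Polynomial.C a) y =
      Polynomial.X - Polynomial.C (value (a : Series) y) := by
  filter_upwards [(isConvPuiseux_coe a).eventually_hasValue] with y hy
  ext n
  rw [valuePoly_coeff, Polynomial.coeff_sub, Polynomial.coeff_sub, Polynomial.coeff_X,
    Polynomial.coeff_X, Polynomial.coeff_C, Polynomial.coeff_C]
  refine HasValue.value_eq ?_
  push_cast
  refine HasValue.sub ?_ ?_
  · split_ifs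
    · exact hasValue_one y
    · exact hasValue_zero y
  · split_ifs
    · exact hy
    · exact hasValue_zero y

theorem valuePoly_C (a : ConvPuiseux) (y : ℝ) :
    valuePoly (Polynomial.C a) y = Polynomial.C (value (a : Series) y) := by
  ext n
  rw [valuePoly_coeff, Polynomial.coeff_C, Polynomial.coeff_C]
  split_ifs
  · rfl
  · exact value_zero y

theorem eventually_valuePoly_prod (M : Multiset L) : ∀ᶠ y : ℝ in 𝓝[>] 0,
    valuePoly ((M.map fun z => Polynomial.X - Polynomial.C (embed z)).prod) y =
      ((M.map (evalAt y)).map fun a => Polynomial.X - Polynomial.C a).prod := by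
  induction M using Multiset.induction_on with
  | empty =>
    refine Eventually.of_forall fun y => ?_
    simp only [Multiset.map_zero, Multiset.prod_zero]
    rw [← Polynomial.C_1, valuePoly_C]
    exact congrArg Polynomial.C (hasValue_one y).value_eq
  | cons z M ih =>
    filter_upwards [ih, eventually_valuePoly_X_sub_C (embed z), eventually_valuePoly_mul
      (Polynomial.X - Polynomial.C (embed z))
      ((M.map fun z => Polynomial.X - Polynomial.C (embed z)).prod)] with y h1 h2 h3
    simp only [Multiset.map_cons, Multiset.prod_cons]
    rw [h3, h2, h1]
    rfl

/-- For small `y > 0` the roots of `Q(y, X)` are the values at `y` of the Puiseux expansions of the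
roots of `Q(Y, X)`. -/
theorem eventually_roots_specialize {Q : Polynomial (Polynomial ℚ)} (hQ : overField Q ≠ 0) :
    ∀ᶠ y : ℝ in 𝓝[>] 0,
      (specialize Q y).roots = ((overField Q).aroots L).map (evalAt y) := by
  set f := overField Q with hf
  have hfac : f.map toConvPuiseux = Polynomial.C (toConvPuiseux f.leadingCoeff) *
      ((f.aroots L).map fun z => Polynomial.X - Polynomial.C (embed z)).prod := by
    have h1 := congrArg (Polynomial.map embed)
      (IsAlgClosed.splits (f.map (algebraMap K L))).eq_prod_roots
    have h2 : embed.comp (algebraMap K L) = toConvPuiseux := RingHom.ext embed_algebraMap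
    rw [Polynomial.map_map, h2, Polynomial.map_mul, Polynomial.map_C, Polynomial.map_multiset_prod,
      Multiset.map_map, Polynomial.leadingCoeff_map, embed_algebraMap] at h1
    rw [h1]
    congr 2
    refine Multiset.map_congr rfl fun z _ => ?_
    simp
  have hlc : (toConvPuiseux f.leadingCoeff : Series) ≠ 0 := by
    intro h
    have h1 : toConvPuiseux f.leadingCoeff = 0 := Subtype.ext h
    exact Polynomial.leadingCoeff_ne_zero.2 hQ ((map_eq_zero _).1 h1)
  filter_upwards [eventually_valuePoly_prod (f.aroots L), eventually_valuePoly_mul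
    (Polynomial.C (toConvPuiseux f.leadingCoeff))
    ((f.aroots L).map fun z => Polynomial.X - Polynomial.C (embed z)).prod,
    (isConvPuiseux_coe (toConvPuiseux f.leadingCoeff)).eventually_value_ne_zero hlc]
    with y h1 h2 h3
  rw [specialize_eq_valuePoly, ← hf, hfac, h2, valuePoly_C, h1, Polynomial.roots_C_mul _ h3,
    Polynomial.roots_multiset_prod_X_sub_C]

theorem conj_mem_roots_specialize (Q : Polynomial (Polynomial ℚ)) (y : ℝ) {z : ℂ}
    (hz : z ∈ (specialize Q y).roots) : starRingEnd ℂ z ∈ (specialize Q y).roots := by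
  have hmap : (specialize Q y).map (starRingEnd ℂ) = specialize Q y := by
    rw [specialize, Polynomial.map_map]
    congr 1
    refine Polynomial.ringHom_ext (fun a => ?_) ?_ <;> simp
  rw [Polynomial.mem_roots'] at hz ⊢
  refine ⟨hz.1, ?_⟩
  rw [Polynomial.IsRoot, ← hmap, Polynomial.eval_map_apply, hz.2.eq_zero, map_zero]

/-! ### The rounds of the algorithm -/

theorem aroots_eq_of_map_eq {p : Polynomial K} {M : Multiset L}
    (h : p.map (algebraMap K L) = (M.map fun a => Polynomial.X - Polynomial.C a).prod) :
    p.aroots L = M := by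
  rw [Polynomial.aroots_def, h, Polynomial.roots_multiset_prod_X_sub_C]

theorem aroots_subsetProducts (f : Polynomial K) (m : ℕ) :
    (subsetProducts f m).aroots L = (Multiset.powersetCard m (f.aroots L)).map Multiset.prod :=
  aroots_eq_of_map_eq (subsetProducts_map f m)

theorem aroots_tensorSquare (f : Polynomial K) :
    (tensorSquare f).aroots L = (f.aroots L ×ˢ f.aroots L).map fun p => p.1 * p.2 :=
  aroots_eq_of_map_eq (tensorSquare_map f)

/-- For small `y > 0` the values of the roots of `𝒫_m ⊗ 𝒫_m` are the products of pairs of `m`-fold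
products of values of roots. -/
theorem eventually_map_evalAt_aroots_tensorSquare (f : Polynomial K) (m : ℕ) :
    ∀ᶠ y : ℝ in 𝓝[>] 0, ((tensorSquare (subsetProducts f m)).aroots L).map (evalAt y) =
      productPairs ((f.aroots L).map (evalAt y)) m := by
  have h1 := eventually_forall_mem (Multiset.powersetCard m (f.aroots L)) fun s _ =>
    eventually_evalAt_prod s
  have h2 := eventually_forall_mem (Multiset.powersetCard m (f.aroots L)) fun s _ =>
    eventually_forall_mem (Multiset.powersetCard m (f.aroots L)) fun s' _ =>
      eventually_evalAt_mul s.prod s'.prod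
  filter_upwards [h1, h2] with y h1 h2
  rw [aroots_tensorSquare, aroots_subsetProducts, productPairs, Multiset.powersetCard_map]
  simp only [SProd.sprod, Multiset.product, Multiset.map_bind, Multiset.bind_map,
    Multiset.map_map, Function.comp]
  refine Multiset.bind_congr fun s hs => Multiset.map_congr rfl fun s' hs' => ?_
  rw [h2 s hs s' hs', h1 s hs, h1 s' hs']

/-- One round: with `m` one more than the number of roots of modulus greater than `ρ`, the procedure
applied to `𝒫_m` returns the number of roots of modulus `ρ`. -/
theorem dominantIndex_subsetProducts {f : Polynomial K} {y : ℝ} {S : Finset ℂ} {ρ : ℝ}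
    (hS : (f.aroots L).map (evalAt y) = S.val) (hconj : ∀ z ∈ S, starRingEnd ℂ z ∈ S)
    (hρ : ∃ z ∈ S, ‖z‖ = ρ)
    (hT : ((tensorSquare (subsetProducts f ((outer S ρ).card + 1))).aroots L).map (evalAt y) =
      productPairs ((f.aroots L).map (evalAt y)) ((outer S ρ).card + 1))
    (hsep : Separates y ((tensorSquare (subsetProducts f ((outer S ρ).card + 1))).aroots L)) :
    dominantIndex (subsetProducts f ((outer S ρ).card + 1)) = Part.some (onCircle S ρ).card := by
  classical
  have hρ0 : 0 ≤ ρ := by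
    obtain ⟨z, -, rfl⟩ := hρ
    exact norm_nonneg z
  set T := tensorSquare (subsetProducts f ((outer S ρ).card + 1)) with hTdef
  set M : ℝ := (‖∏ z ∈ outer S ρ, z‖ * ρ) ^ 2 with hM
  have hM0 : 0 ≤ M := sq_nonneg _
  rw [hS] at hT
  have hcount := count_productPairs hconj hρ0
  rw [← hT] at hcount
  have hmem : (M : ℂ) ∈ (T.aroots L).map (evalAt y) := by
    rw [← Multiset.one_le_count_iff_mem, Nat.one_le_iff_ne_zero]
    obtain ⟨z, hz, hzρ⟩ := hρ
    have : 0 < (onCircle S ρ).card := Finset.card_pos.2 ⟨z, mem_onCircle.2 ⟨hz, hzρ⟩⟩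
    intro h
    have h' := hcount.symm.trans (by convert h)
    omega
  obtain ⟨z₀, hz₀, hz₀M⟩ := Multiset.mem_map.1 hmem
  have hgreat : IsGreatestNonnegRoot T z₀ := by
    have hnn : IsNonnegSeries (expand z₀) := (hsep.nonneg_iff z₀ hz₀).2 (by
      rw [hz₀M]
      exact ⟨Complex.ofReal_im M, hM0⟩)
    refine ⟨hz₀, hnn, fun z hz hzz hzn => hsep.lt z hz z₀ hz₀ hzn hnn ?_⟩
    obtain ⟨him, hre⟩ := (hsep.nonneg_iff z hz).1 hzn
    rw [hz₀M, Complex.ofReal_re]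
    have hle : ‖evalAt y z‖ ≤ M := by
      refine norm_le_of_mem_productPairs hρ0 ?_
      rw [← hT]
      exact Multiset.mem_map_of_mem _ hz
    refine lt_of_le_of_ne ((Complex.re_le_norm _).trans hle) fun heq => hzz ?_
    refine hsep.inj z hz z₀ hz₀ ?_
    rw [hz₀M]
    exact Complex.ext (by rw [heq, Complex.ofReal_re]) (by rw [him, Complex.ofReal_im])
  rw [dominantIndex_eq hgreat, ← hcount, ← hz₀M, Multiset.count_map_eq_count (evalAt y) _
    (fun z hz z' hz' h => hsep.inj z hz z' hz' h) _ hz₀]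

/-- For every small `y > 0` the algorithm returns the list of root counts of `Q(y, X)`. -/
theorem eventually_algorithm_eq {Q : Polynomial (Polynomial ℚ)} (hQ : Squarefree Q) :
    ∀ᶠ y : ℝ in 𝓝[>] 0, algorithm Q = Part.some (moduliCounts (specialize Q y)) := by
  classical
  set f := overField Q with hf
  have hsq : Squarefree f := squarefree_overField hQ
  have hnodup : (f.aroots L).Nodup := nodup_aroots_of_squarefree hsq
  have hcard : (f.aroots L).card = f.natDegree := by
    rw [Polynomial.aroots_def, IsAlgClosed.card_roots_eq_natDegree, Polynomial.natDegree_map]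
  have hT := eventually_forall_mem (Multiset.range (f.natDegree + 1)) fun m _ =>
    (eventually_map_evalAt_aroots_tensorSquare f m).and
      (eventually_separates ((tensorSquare (subsetProducts f m)).aroots L))
  filter_upwards [eventually_roots_specialize hsq.ne_zero, eventually_separates (f.aroots L), hT]
    with y hroots hsep hT
  rw [← hf] at hroots
  have hnd : ((f.aroots L).map (evalAt y)).Nodup :=
    (Multiset.nodup_map_iff_inj_on hnodup).2 fun z hz z' hz' => hsep.inj z hz z' hz'
  let S : Finset ℂ := ⟨(f.aroots L).map (evalAt y), hnd⟩
  have hS : (f.aroots L).map (evalAt y) = S.val := rfl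
  have hp : (specialize Q y).roots = S.val := hroots
  have hSc : S.card = f.natDegree := by
    rw [Finset.card_def, ← hS, Multiset.card_map, hcard]
  have hconj : ∀ z ∈ S, starRingEnd ℂ z ∈ S := fun z hz => by
    rw [← Finset.mem_val, ← hp] at hz ⊢
    exact conj_mem_roots_specialize Q y hz
  refine round_fix_eq ((sum_moduliCounts hp).trans hSc) (moduliCounts_pos hp) fun k hk => ?_
  have hk' : k < (moduli (specialize Q y)).length := by
    simpa only [moduliCounts, List.length_map] using hk
  have hk2 : (moduliCounts (specialize Q y))[k] =
      (onCircle S (moduli (specialize Q y))[k]).card := by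
    simp only [moduliCounts_eq hp, List.getElem_map]
  rw [sum_take_moduliCounts hp hk', hk2]
  have hρ := (mem_moduli hp).1 (List.getElem_mem hk')
  have hm : (outer S (moduli (specialize Q y))[k]).card + 1 ∈
      Multiset.range (f.natDegree + 1) := by
    obtain ⟨c, hc, hcρ⟩ := hρ
    have hlt : (outer S (moduli (specialize Q y))[k]).card < S.card :=
      Finset.card_lt_card ((Finset.filter_ssubset).2 ⟨c, hc, by rw [hcρ]; exact lt_irrefl _⟩)
    rw [Multiset.mem_range]
    omega
  exact dominantIndex_subsetProducts hS hconj hρ (hT _ hm).1 (hT _ hm).2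

end RootModuli
end

theorem mainTheorem5 (Q : Polynomial (Polynomial ℚ)) (hQ : Squarefree Q) :
    ∃ q : List ℕ, RootModuli.algorithm Q = Part.some q ∧
      ∀ᶠ y : ℝ in 𝓝[>] 0, RootModuli.moduliCounts (RootModuli.specialize Q y) = q := by
  -- the algorithm does not depend on `y`, so that neither do the root counts, which it returns
  have h := RootModuli.eventually_algorithm_eq hQ
  obtain ⟨y₀, hy₀⟩ := h.exists
  refine ⟨_, hy₀, ?_⟩
  filter_upwards [h] with y hy
  exact Part.some_injective (hy.symm.trans hy₀)
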